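/- Let $\Phi$ be an irreducible reduced crystallographic (finite) root system with simple roots $\alpha_i$ ($i\in I$), positive roots $\Phi^+$, highest root $\theta$, Weyl group $W$ with length function $\ell$, and weight lattice $X=\bigoplus_{i\in I}\mathbb Z\omega_i$. Let $X_{\mathrm{af}}$ be the weight lattice of the associated untwisted affine root system, with null root $\delta$, simple roots $\alpha_i$ ($i\in I$) and $\alpha_0=\delta-\theta$, and simple coroots $\alpha_i^\vee$ ($i\in I$) and $\alpha_0^\vee=c-\theta^\vee$, where $c$ is the canonical central element; let $W_{\mathrm{af}}$ be the affine Weyl group acting on $X_{\mathrm{af}}$, $\Phi^{\mathrm{af}+}$ the set of positive affine real roots, and for $\beta\in\Phi^{\mathrm{af}+}$ let $r_\beta$ and $\beta^\vee$ be its reflection and coroot. View $X$ as a sublattice of the level-zero weights in $X_{\mathrm{af}}$, and let $\mathrm{cl}:X_{\mathrm{af}}\to X$ be the projection with kernel $\mathbb Z\Lambda_0\oplus\mathbb Z\delta$. Fix a dominant weight $\lambda\in X$. Let $J=\{i\in I:\langle\alpha_i^\vee,\lambda\rangle=0\}$, let $W_J$ be the stabilizer of $\lambda$ in $W$, $W^J$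 the set of minimal-length representatives of the cosets $W/W_J$, and $\lfloor v\rfloor\in W^J$ the representative of $vW_J$; let $\Phi_J^+=\Phi^+\cap\bigoplus_{i\in J}\mathbb Z\alpha_i$, and let $\rho$ and $\rho_J$ be the half-sums of $\Phi^+$ and of $\Phi_J^+$. The parabolic quantum Bruhat graph $\mathrm{QB}(W^J)$ has vertex set $W^J$ and edges $w\xrightarrow{\gamma}\lfloor wr_\gamma\rfloor$ with $w\in W^J$ and $\gamma\in\Phi^+\setminus\Phi_J^+$ of two kinds: Bruhat edges, when $w\lessdot wr_\gamma$ is a cover in the Bruhat order of $W$, and quantum edges, when $\ell(\lfloor wr_\gamma\rfloor)=\ell(w)+1-\langle\gamma^\vee,2\rho-2\rho_J\rangle$. The level-zero weight poset is the orbit $X^0_{\mathrm{af}}(\lambda)=W_{\mathrm{af}}\lambda$, ordered by the transitive closure of the relations $\mu<r_\beta(\mu)$ for $\beta\in\Phi^{\mathrm{af}+}$ with $\langle\beta^\vee,\mu\rangle>0$. A cover $\mu\lessdot\nu=r_\beta(\mu)$ is labeled by $\beta$. **Theorem.** For every $\mu\in X^0_{\mathrm{af}}(\lambda)$ there is a unique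 $w\in W^J$ with $w\lambda=\mathrm{cl}(\mu)$; in this way we identify $\mathrm{cl}(\mu)$ with $w$. Let $\mu\in X^0_{\mathrm{af}}(\lambda)$ and $w=\mathrm{cl}(\mu)\in W^J$. 1. If $\mu\lessdot\nu$ is a cover in $X^0_{\mathrm{af}}(\lambda)$, then it has a unique label $\beta$, and $\beta\in\Phi^+$ or $\beta\in\delta-\Phi^+$. If $\beta\in\Phi^+$, then $w\to\mathrm{cl}(\nu)$ is a Bruhat edge of $\mathrm{QB}(W^J)$ with label $w^{-1}(\beta)\in\Phi^+\setminus\Phi_J^+$. If $\beta\in\delta-\Phi^+$, then $w\to\mathrm{cl}(\nu)$ is a quantum edge of $\mathrm{QB}(W^J)$ with label $w^{-1}(\beta-\delta)\in\Phi^+\setminus\Phi_J^+$. 2. Conversely, if $w\xrightarrow{\gamma}w'$ is a Bruhat (respectively quantum) edge of $\mathrm{QB}(W^J)$ with $\gamma\in\Phi^+\setminus\Phi_J^+$, then there is a cover $\mu\lessdot\nu$ in $X^0_{\mathrm{af}}(\lambda)$ with label $w(\gamma)$ (respectively $\delta+w(\gamma)$) and $\mathrm{cl}(\nu)=w'$.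 -/

import Mathlib

noncomputable section

namespace LevelZero

open Module

variable {ι V V' : Type*} [AddCommGroup V] [Module ℚ V] [AddCommGroup V'] [Module ℚ V']
  {P : RootPairing ι ℚ V V'}

/-! ### The finite Weyl group and the parabolic quantum Bruhat graph -/

/-- The highest root: subtracting any root from it leaves a nonnegative integral combination of
simple roots. -/
def IsHighestRoot (b : P.Base) (θ : ι) : Prop :=
  ∀ i, P.root θ - P.root i ∈ AddSubmonoid.closure (P.root '' b.support)

/-- Dominant elements of the weight lattice `X = ⨁ ℤ ω_i`: the pairing with every simple coroot is
a nonnegative integer. -/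
def IsDominantWeight (b : P.Base) (lam : V) : Prop :=
  ∀ i ∈ b.support, ∃ n : ℕ, P.toLinearMap lam (P.coroot i) = n

/-- The length of `w`: the least number of factors in a product of simple reflections equal
to `w`. -/
def len (b : P.Base) (w : P.weylGroup) : ℕ :=
  sInf {n | ∃ l : List b.support, l.length = n ∧
    (l.map fun i => RootPairing.weylGroup.ofIdx P i).prod = w}

/-- The strict Bruhat order on the finite Weyl group. -/
def BruhatLT (b : P.Base) : P.weylGroup → P.weylGroup → Prop :=
  Relation.TransGen fun u v =>
    ∃ i : ι, v = u * RootPairing.weylGroup.ofIdx P i ∧ len b u < len b v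

/-- Cover relations of the Bruhat order. -/
def BruhatCover (b : P.Base) (u v : P.weylGroup) : Prop :=
  BruhatLT b u v ∧ ¬ ∃ z, BruhatLT b u z ∧ BruhatLT b z v

/-- The set `J` of simple roots whose coroot pairs to zero with `lam`. -/
def stabSimple (b : P.Base) (lam : V) : Set ι :=
  {i | i ∈ b.support ∧ P.toLinearMap lam (P.coroot i) = 0}

/-- `W_J`, the stabilizer of `lam` in the finite Weyl group. -/
def stab (P : RootPairing ι ℚ V V') (lam : V) : Subgroup P.weylGroup :=
  MulAction.stabilizer P.weylGroup lam

/-- `W^J`: the elements of minimal length in their coset of `W_J`. -/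
def minReps (b : P.Base) (lam : V) : Set P.weylGroup :=
  {w | ∀ u ∈ stab P lam, len b w ≤ len b (w * u)}

/-- (Indices of) the positive roots `Φ⁺`. -/
def posIdx (b : P.Base) : Set ι := {i | b.IsPos i}

/-- (Indices of) `Φ_J⁺`: the positive roots in the lattice spanned by the simple roots in `J`. -/
def posIdxJ (b : P.Base) (lam : V) : Set ι :=
  {i | b.IsPos i ∧ P.root i ∈ Submodule.span ℤ (P.root '' stabSimple b lam)}

/-- `ρ`, half the sum of the positive roots. -/
def rho (b : P.Base) : V := (1 / 2 : ℚ) • ∑ᶠ i ∈ posIdx b, P.root i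

/-- `ρ_J`, half the sum of the roots in `Φ_J⁺`. -/
def rhoJ (b : P.Base) (lam : V) : V := (1 / 2 : ℚ) • ∑ᶠ i ∈ posIdxJ b lam, P.root i

/-- `v'` is the minimal length representative `⌊v⌋` of the coset `v W_J`. -/
def IsFloor (b : P.Base) (lam : V) (v v' : P.weylGroup) : Prop :=
  v' ∈ minReps b lam ∧ v⁻¹ * v' ∈ stab P lam

/-- Bruhat (up) edges `w → w' = ⌊w r_γ⌋` of `QB(W^J)`, with label `γ ∈ Φ⁺ \ Φ_J⁺`. -/
def BruhatEdge (b : P.Base) (lam : V) (w : P.weylGroup) (γ : ι) (w' : P.weylGroup) : Prop :=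
  w ∈ minReps b lam ∧ γ ∈ posIdx b \ posIdxJ b lam ∧
    IsFloor b lam (w * RootPairing.weylGroup.ofIdx P γ) w' ∧
    BruhatCover b w (w * RootPairing.weylGroup.ofIdx P γ)

/-- Quantum (down) edges `w → w' = ⌊w r_γ⌋` of `QB(W^J)`, with label `γ ∈ Φ⁺ \ Φ_J⁺`. -/
def QuantumEdge (b : P.Base) (lam : V) (w : P.weylGroup) (γ : ι) (w' : P.weylGroup) : Prop :=
  w ∈ minReps b lam ∧ γ ∈ posIdx b \ posIdxJ b lam ∧
    IsFloor b lam (w * RootPairing.weylGroup.ofIdx P γ) w' ∧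
    (len b w' : ℚ) = len b w + 1 -
      P.toLinearMap ((2 : ℚ) • rho b - (2 : ℚ) • rhoJ b lam) (P.coroot γ)

/-! ### The untwisted affinization -/

/-- The rational span of the affine weight lattice `X_af`: the triple `(x, k, n)` stands for
`x + k Λ₀ + n δ`, where `x` is an element of level zero in the rational span of the finite weight
lattice. (So `Λ_i` is `(ω_i, a_i, 0)`, with `a_i` the coefficient of the simple coroot `i` in the
coroot of the highest root.) -/
abbrev AffSpace (V : Type*) : Type _ := V × ℚ × ℚ

/-- The inclusion of the finite weights as affine weights of level zero. -/
def emb (x : V) : AffSpace V := (x, 0, 0)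

/-- The projection `cl`, with kernel spanned by `Λ₀` and `δ`. -/
def cl (μ : AffSpace V) : V := μ.1

/-- The null root `δ`. -/
def delta : AffSpace V := (0, 0, 1)

/-- The simple affine roots, indexed by `I_af = I ⊔ {0}` with `none` for the node `0`:
`α_0 = δ - θ`. -/
def affSimpleRoot (b : P.Base) (θ : ι) : Option b.support → AffSpace V
  | none => delta - emb (P.root θ)
  | some i => emb (P.root i)

/-- The simple affine coroots: `α_i^∨` for `i ∈ I`, and `α_0^∨ = c - θ^∨` with `c` the canonical
central element, whose value is the level, i.e. the coefficient of `Λ₀`. -/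
def affSimpleCoroot (b : P.Base) (θ : ι) : Option b.support → Dual ℚ (AffSpace V)
  | none => LinearMap.fst ℚ ℚ ℚ ∘ₗ LinearMap.snd ℚ V (ℚ × ℚ) -
      P.toLinearMap.flip (P.coroot θ) ∘ₗ LinearMap.fst ℚ V (ℚ × ℚ)
  | some i => P.toLinearMap.flip (P.coroot i) ∘ₗ LinearMap.fst ℚ V (ℚ × ℚ)

theorem affSimpleCoroot_affSimpleRoot (b : P.Base) (θ : ι) (i : Option b.support) :
    affSimpleCoroot b θ i (affSimpleRoot b θ i) = 2 := by
  cases i <;> simp [affSimpleCoroot, affSimpleRoot, delta, emb]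

/-- The simple affine reflections `μ ↦ μ - ⟨α_i^∨, μ⟩ α_i`. -/
def affSimpleReflection (b : P.Base) (θ : ι) (i : Option b.support) :
    AffSpace V ≃ₗ[ℚ] AffSpace V :=
  Module.reflection (affSimpleCoroot_affSimpleRoot b θ i)

/-- The affine Weyl group `W_af`, in its faithful action on affine weights. -/
def affWeyl (b : P.Base) (θ : ι) : Subgroup (AffSpace V ≃ₗ[ℚ] AffSpace V) :=
  Subgroup.closure (Set.range (affSimpleReflection b θ))

/-- The positive affine real roots: images of simple affine roots under `W_af` that are nonnegative
integral combinations of simple affine roots. -/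
def affPosRoots (b : P.Base) (θ : ι) : Set (AffSpace V) :=
  {β | (∃ x ∈ affWeyl b θ, ∃ i, β = x (affSimpleRoot b θ i)) ∧
    β ∈ AddSubmonoid.closure (Set.range (affSimpleRoot b θ))}

/-- The affine real root `β = x α_i` has reflection `r_β = x r_i x⁻¹` and coroot
`β^∨ = x α_i^∨`, where `x` acts on the dual by `(x f) μ = f (x⁻¹ μ)`. -/
def HasReflectionCoroot (b : P.Base) (θ : ι) (β : AffSpace V)
    (r : AffSpace V ≃ₗ[ℚ] AffSpace V) (f : Dual ℚ (AffSpace V)) : Prop :=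
  ∃ x ∈ affWeyl b θ, ∃ i, β = x (affSimpleRoot b θ i) ∧
    r = x * affSimpleReflection b θ i * x⁻¹ ∧
    f = affSimpleCoroot b θ i ∘ₗ (x⁻¹ : AffSpace V ≃ₗ[ℚ] AffSpace V).toLinearMap

/-! ### The level-zero weight poset -/

/-- `X_af^0(lam)`, the orbit of `lam` under the affine Weyl group. -/
def orbit (b : P.Base) (θ : ι) (lam : V) : Set (AffSpace V) :=
  {μ | ∃ x ∈ affWeyl b θ, μ = x (emb lam)}

/-- `β` is a positive affine real root with `⟨μ, β^∨⟩ > 0` and `ν = r_β μ`. -/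
def IsLabel (b : P.Base) (θ : ι) (β μ ν : AffSpace V) : Prop :=
  β ∈ affPosRoots b θ ∧ ∃ r f, HasReflectionCoroot b θ β r f ∧ 0 < f μ ∧ ν = r μ

/-- The strict order of the level-zero weight poset. -/
def WeightLT (b : P.Base) (θ : ι) (lam : V) : orbit b θ lam → orbit b θ lam → Prop :=
  Relation.TransGen fun μ ν => ∃ β, IsLabel b θ β μ ν

/-- Cover relations of the level-zero weight poset. -/
def WeightCover (b : P.Base) (θ : ι) (lam : V) (μ ν : orbit b θ lam) : Prop :=
  WeightLT b θ lam μ ν ∧ ¬ ∃ ξ, WeightLT b θ lam μ ξ ∧ WeightLT b θ lam ξ ν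

/-- The finite positive roots `Φ⁺`, as affine weights. -/
def finPosRoots (b : P.Base) : Set (AffSpace V) :=
  {β | ∃ i, b.IsPos i ∧ β = emb (P.root i)}

end LevelZero

end

/-!
The level-zero weight poset is an order generated by reflections on which the simple affine
reflections `r_i` act. An edge `μ → r_β μ` whose label `β` is not simple is carried by `r_i`, for
`β ≠ α_i`, to an edge labeled `r_i β`. If moreover `⟨α_i^∨, β⟩ > 0`, then the label becomes smaller,
and the pairing with `α_i^∨` decreases strictly from `μ` to `ν = r_β μ`. If the edge is a cover,
then lifting a chain through `r_i` shows that `⟨α_i^∨, μ⟩` and `⟨α_i^∨, ν⟩` are both positive or both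
negative, and that `r_i μ ⋖ r_i ν` is again a cover. So covers can be followed down to edges with a
simple label.

Every edge has a degree which can be followed in the same way. For `μ` over `x = w λ` and
`β = α_j + k δ` it is

  `ℓ(⌊r_j w⌋) - ℓ(w) + k ⟨(w⁻¹ α_j)^∨, 2ρ - 2ρ_J⟩`,

a difference of semi-infinite lengths. It is one for simple labels, and `r_i` changes it by
`sgn ⟨α_i^∨, ν⟩ - sgn ⟨α_i^∨, μ⟩`. By the descent every edge has degree at least one, and an edge is
a cover exactly if its degree is one (`ReflectionOrder.Cover.deg_eq_one` and
`ReflectionOrder.cover_of_deg_eq_one`). For `k = 1`, degree one is the defining equation of a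
quantum edge; for `k = 0` it says that the length of the minimal representative rises by one. The descent
also shows that no other labels `k` occur on covers (`label_of_deg_eq_one`).

The lengths are computed as signed counts over all roots: `signSum b x` is the sum of
`sgn(α) sgn⟨α^∨, x⟩`, from which the length of the minimal representative over `x` is read off
(`len_eq_of_mem_minReps`), and `signRoot P x`, the sum of `sgn⟨α^∨, x⟩ α`, is the translate of
`4ρ - 4ρ_J` by `w` (`signRoot_smul`, `signRoot_eq`). That the degree behaves as claimed under `r_0`
rests on the pairings of the coroot of the highest root with the other positive roots being `0` or
`1` (`IsHighestRoot.signSum_smul`).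

The same argument for the finite Weyl group acting on itself, with the difference of the lengths as
the degree, shows that covers of the Bruhat order raise the length by one (`bruhatCover_iff_len`).
-/

namespace LevelZero

/-! ### Covers in orders generated by reflections -/

/-- An order on `O` generated by edges `μ → ν` with labels in `B` ("positive roots"), on which
"simple reflections" indexed by `I` act. The sign `sgn i μ` is that of the pairing of `μ` with the
simple coroot `i`, and `Desc i β` says that this coroot pairs positively with the label `β`. The
degree of an edge changes under a simple reflection as a difference of lengths does. -/
structure ReflectionOrder (I O B : Type*) where
  /-- The simple reflections of `O`. -/
  refl : I → O → O
  /-- The action of the simple reflections on labels. -/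
  act : I → B → B
  /-- The simple labels. -/
  simple : I → B
  /-- The labeled edges. -/
  Edge : B → O → O → Prop
  /-- The sign of the pairing with a simple coroot. -/
  sgn : I → O → SignType
  /-- A function that increases along edges. -/
  rank : O → ℚ
  /-- The height of a label. -/
  height : B → ℕ
  /-- The simple reflection `i` lowers the label. -/
  Desc : I → B → Prop
  /-- The degree of the edge with a given label and source. -/
  deg : B → O → ℚ
  refl_refl : ∀ i μ, refl i (refl i μ) = μ
  sgn_refl : ∀ i μ, sgn i (refl i μ) = -sgn i μ
  refl_of_sgn_eq_zero : ∀ i μ, sgn i μ = 0 → refl i μ = μ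
  edge_simple : ∀ i μ ν, Edge (simple i) μ ν ↔ sgn i μ = 1 ∧ ν = refl i μ
  edge_act : ∀ i β μ ν, Edge β μ ν → β ≠ simple i → Edge (act i β) (refl i μ) (refl i ν)
  edge_unique : ∀ β β' μ ν, Edge β μ ν → Edge β' μ ν → β = β'
  rank_lt : ∀ β μ ν, Edge β μ ν → rank μ < rank ν
  exists_desc : ∀ β μ ν, Edge β μ ν → ∃ i, Desc i β
  height_lt : ∀ i β μ ν, Edge β μ ν → β ≠ simple i → Desc i β → height (act i β) < height β
  sgn_le : ∀ i β μ ν, Edge β μ ν → Desc i β → sgn i ν ≤ sgn i μ ∧ (sgn i μ = 0 → sgn i ν ≠ 0)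
  deg_simple : ∀ i μ ν, Edge (simple i) μ ν → deg (simple i) μ = 1
  deg_act : ∀ i β μ ν, Edge β μ ν → β ≠ simple i →
    deg (act i β) (refl i μ) = deg β μ + (sgn i ν : ℚ) - (sgn i μ : ℚ)

namespace ReflectionOrder

variable {I O B : Type*} (R : ReflectionOrder I O B)

/-- One step up in the order. -/
def Step (μ ν : O) : Prop := ∃ β, R.Edge β μ ν

/-- The strict order. -/
def LT : O → O → Prop := Relation.TransGen R.Step

/-- The weak order. -/
def LE : O → O → Prop := Relation.ReflTransGen R.Step

/-- The cover relation. -/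
def Cover (μ ν : O) : Prop := R.LT μ ν ∧ ¬ ∃ ξ, R.LT μ ξ ∧ R.LT ξ ν

variable {R}

theorem LT.rank_lt {μ ν : O} (h : R.LT μ ν) : R.rank μ < R.rank ν := by
  induction h with
  | single h => obtain ⟨β, h⟩ := h; exact R.rank_lt _ _ _ h
  | tail _ h ih => obtain ⟨β, h⟩ := h; exact ih.trans (R.rank_lt _ _ _ h)

theorem LT.ne {μ ν : O} (h : R.LT μ ν) : μ ≠ ν := by
  rintro rfl
  exact lt_irrefl _ h.rank_lt

theorem LT.le {μ ν : O} (h : R.LT μ ν) : R.LE μ ν := Relation.TransGen.to_reflTransGen h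

theorem LE.trans {μ ν ξ : O} (h : R.LE μ ν) (h' : R.LE ν ξ) : R.LE μ ξ :=
  Relation.ReflTransGen.trans h h'

theorem LE.lt_of_ne {μ ν : O} (h : R.LE μ ν) (hne : μ ≠ ν) : R.LT μ ν := by
  rcases Relation.reflTransGen_iff_eq_or_transGen.1 h with h | h
  · exact absurd h.symm hne
  · exact h

theorem LT.trans_le {μ ν ξ : O} (h : R.LT μ ν) (h' : R.LE ν ξ) : R.LT μ ξ :=
  Relation.TransGen.trans_left h h'

theorem LT.not_le {μ ν : O} (h : R.LT μ ν) : ¬ R.LE ν μ := fun h' => (h.trans_le h').ne rfl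

theorem Cover.eq_or_eq {μ ν ξ : O} (h : R.Cover μ ν) (h₁ : R.LE μ ξ) (h₂ : R.LE ξ ν) :
    μ = ξ ∨ ξ = ν := by
  by_contra hne
  rw [not_or] at hne
  exact h.2 ⟨ξ, h₁.lt_of_ne hne.1, h₂.lt_of_ne hne.2⟩

theorem lt_refl_of_sgn_pos {i : I} {μ : O} (h : R.sgn i μ = 1) : R.LT μ (R.refl i μ) :=
  .single ⟨R.simple i, (R.edge_simple _ _ _).2 ⟨h, rfl⟩⟩

theorem refl_lt_of_sgn_neg {i : I} {μ : O} (h : R.sgn i μ = -1) : R.LT (R.refl i μ) μ := by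
  have := lt_refl_of_sgn_pos (R := R) (i := i) (μ := R.refl i μ) (by rw [R.sgn_refl, h]; rfl)
  rwa [R.refl_refl] at this

theorem le_refl_of_sgn_nonneg {i : I} {μ : O} (h : 0 ≤ R.sgn i μ) : R.LE μ (R.refl i μ) := by
  rcases hs : R.sgn i μ with _ | _ | _
  · rw [R.refl_of_sgn_eq_zero i μ hs]; exact .refl
  · rw [hs] at h; exact absurd h (by decide)
  · exact (lt_refl_of_sgn_pos hs).le

theorem refl_le_of_sgn_nonpos {i : I} {μ : O} (h : R.sgn i μ ≤ 0) : R.LE (R.refl i μ) μ := by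
  rcases hs : R.sgn i μ with _ | _ | _
  · rw [R.refl_of_sgn_eq_zero i μ hs]; exact .refl
  · exact (refl_lt_of_sgn_neg hs).le
  · rw [hs] at h; exact absurd h (by decide)

/-- Reflect a chain edge by edge: this works up to the last edge with the label `simple i`,
from whose source `ξ` the remaining edges are reflected. -/
theorem LE.refl_or_last {μ ν : O} (i : I) (h : R.LE μ ν) :
    R.LE (R.refl i μ) (R.refl i ν) ∨
      ∃ ξ, R.sgn i ξ = 1 ∧ R.LE μ ξ ∧ R.LE ξ (R.refl i ν) := by
  induction h with
  | refl => exact .inl .refl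
  | @tail ν ν' h h' ih =>
    obtain ⟨β, hβ⟩ := h'
    by_cases hs : β = R.simple i
    · subst hs
      obtain ⟨hs, rfl⟩ := (R.edge_simple _ _ _).1 hβ
      exact .inr ⟨ν, hs, h, by rw [R.refl_refl]; exact .refl⟩
    · have hstep : R.Step (R.refl i ν) (R.refl i ν') := ⟨_, R.edge_act _ _ _ _ hβ hs⟩
      rcases ih with ih | ⟨ξ, h₁, h₂, h₃⟩
      · exact .inl (ih.tail hstep)
      · exact .inr ⟨ξ, h₁, h₂, h₃.tail hstep⟩

/-- Reflect a chain edge by edge: this works up to the first edge with the label `simple i`,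
to whose target `ξ` the edges before it are reflected. -/
theorem LE.refl_or_first {μ ν : O} (i : I) (h : R.LE μ ν) :
    R.LE (R.refl i μ) (R.refl i ν) ∨
      ∃ ξ, R.sgn i ξ = -1 ∧ R.LE (R.refl i μ) ξ ∧ R.LE ξ ν := by
  induction h using Relation.ReflTransGen.head_induction_on with
  | refl => exact .inl .refl
  | @head μ μ' h' h ih =>
    obtain ⟨β, hβ⟩ := h'
    by_cases hs : β = R.simple i
    · subst hs
      obtain ⟨hs, rfl⟩ := (R.edge_simple _ _ _).1 hβ
      exact .inr ⟨R.refl i μ, by rw [R.sgn_refl, hs], .refl, h⟩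
    · have hstep : R.Step (R.refl i μ) (R.refl i μ') := ⟨_, R.edge_act _ _ _ _ hβ hs⟩
      rcases ih with ih | ⟨ξ, h₁, h₂, h₃⟩
      · exact .inl (ih.head hstep)
      · exact .inr ⟨ξ, h₁, h₂.head hstep, h₃⟩

theorem LE.refl_le {i : I} {μ ν : O} (h : R.LE μ ν) (hν : R.sgn i ν ≤ 0) :
    R.LE (R.refl i μ) ν := by
  rcases h.refl_or_first i with h | ⟨ξ, -, h₁, h₂⟩
  · exact h.trans (refl_le_of_sgn_nonpos hν)
  · exact h₁.trans h₂

theorem LE.le_refl {i : I} {μ ν : O} (h : R.LE μ ν) (hμ : 0 ≤ R.sgn i μ) :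
    R.LE μ (R.refl i ν) := by
  rcases h.refl_or_last i with h | ⟨ξ, -, h₁, h₂⟩
  · exact (le_refl_of_sgn_nonneg hμ).trans h
  · exact h₁.trans h₂

/-- If `i` raises `μ` and does not raise `ν`, then `refl i μ` lies between `μ` and `ν`, so it is
equal to `ν` if `μ ⋖ ν`. -/
theorem Cover.eq_simple_of_sgn_pos {β : B} {i : I} {μ ν : O} (h : R.Cover μ ν)
    (hβ : R.Edge β μ ν) (hμ : R.sgn i μ = 1) (hν : R.sgn i ν ≤ 0) : β = R.simple i := by
  have h₁ := lt_refl_of_sgn_pos hμ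
  rcases h.eq_or_eq h₁.le (h.1.le.refl_le hν) with h₂ | h₂
  · exact absurd h₂ h₁.ne
  · exact R.edge_unique _ _ _ _ hβ ((R.edge_simple _ _ _).2 ⟨hμ, h₂.symm⟩)

/-- If `i` does not lower `μ` and lowers `ν`, then `refl i ν` lies between `μ` and `ν`, so it is
equal to `μ` if `μ ⋖ ν`. -/
theorem Cover.eq_simple_of_sgn_neg {β : B} {i : I} {μ ν : O} (h : R.Cover μ ν)
    (hβ : R.Edge β μ ν) (hμ : 0 ≤ R.sgn i μ) (hν : R.sgn i ν = -1) : β = R.simple i := by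
  have h₁ := refl_lt_of_sgn_neg hν
  rcases h.eq_or_eq (h.1.le.le_refl hμ) h₁.le with h₂ | h₂
  · have hμ' : R.sgn i μ = 1 := by rw [h₂, R.sgn_refl, hν]; rfl
    refine R.edge_unique _ _ _ _ hβ ((R.edge_simple _ _ _).2 ⟨hμ', ?_⟩)
    rw [h₂, R.refl_refl]
  · exact absurd h₂ h₁.ne

/-- A simple reflection preserves a cover between two elements that it both raises or both
lowers. -/
theorem Cover.refl {i : I} {μ ν : O} {β : B} (h : R.Cover μ ν) (hβ : R.Edge β μ ν)
    (hs : β ≠ R.simple i) (heq : R.sgn i μ = R.sgn i ν) (hne : R.sgn i μ ≠ 0) :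
    R.Cover (R.refl i μ) (R.refl i ν) := by
  refine ⟨.single ⟨_, R.edge_act _ _ _ _ hβ hs⟩, ?_⟩
  rintro ⟨ξ, h₁, h₂⟩
  rcases hμ : R.sgn i μ with _ | _ | _
  · exact hne hμ
  · have hν : R.sgn i ν = -1 := heq ▸ hμ
    -- any `simple i` edge in the chain would put `refl i ν < ν` above `μ`
    have key : ¬ R.LE μ (R.refl i ν) := fun hle => by
      rcases h.eq_or_eq hle (refl_lt_of_sgn_neg hν).le with h₃ | h₃
      · have := R.sgn_refl i ν
        rw [← h₃, ← heq, hμ] at this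
        exact absurd this (by decide)
      · exact (refl_lt_of_sgn_neg hν).ne h₃
    rcases h₁.le.refl_or_first i with h₃ | ⟨ζ, -, h₃, h₄⟩
    · rw [R.refl_refl] at h₃
      rcases h₂.le.refl_or_first i with h₄ | ⟨ζ, -, h₄, h₅⟩
      · rw [R.refl_refl] at h₄
        rcases h.eq_or_eq h₃ h₄ with h₅ | h₅
        · exact h₁.ne (by rw [h₅, R.refl_refl])
        · exact h₂.ne (by rw [← h₅, R.refl_refl])
      · exact key (h₃.trans (h₄.trans h₅))
    · rw [R.refl_refl] at h₃
      exact key (h₃.trans (h₄.trans h₂.le))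
  · have hν : R.sgn i ν = 1 := heq ▸ hμ
    -- any `simple i` edge in the chain would put `refl i μ > μ` below `ν`
    have key : ¬ R.LE (R.refl i μ) ν := fun hle => by
      rcases h.eq_or_eq (lt_refl_of_sgn_pos hμ).le hle with h₃ | h₃
      · exact (lt_refl_of_sgn_pos hμ).ne h₃
      · have := R.sgn_refl i μ
        rw [h₃, ← heq, hμ] at this
        exact absurd this (by decide)
    rcases h₂.le.refl_or_last i with h₃ | ⟨ζ, -, h₃, h₄⟩
    · rw [R.refl_refl] at h₃
      rcases h₁.le.refl_or_last i with h₄ | ⟨ζ, -, h₄, h₅⟩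
      · rw [R.refl_refl] at h₄
        rcases h.eq_or_eq h₄ h₃ with h₅ | h₅
        · exact h₁.ne (by rw [h₅, R.refl_refl])
        · exact h₂.ne (by rw [← h₅, R.refl_refl])
      · exact key (h₄.trans (h₅.trans h₃))
    · rw [R.refl_refl] at h₄
      exact key (h₁.le.trans (h₃.trans h₄))

theorem cover_simple {i : I} {μ ν : O} (hβ : R.Edge (R.simple i) μ ν) : R.Cover μ ν := by
  refine ⟨.single ⟨_, hβ⟩, ?_⟩
  rintro ⟨ξ, h₁, h₂⟩
  obtain ⟨hμ, rfl⟩ := (R.edge_simple _ _ _).1 hβ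
  rcases h₁.le.refl_or_first i with h₃ | ⟨ζ, -, h₃, h₄⟩
  · rcases h₂.le.refl_or_last i with h₄ | ⟨ζ, -, h₄, h₅⟩
    · rw [R.refl_refl] at h₄
      exact (lt_refl_of_sgn_pos hμ).not_le (h₃.trans h₄)
    · rw [R.refl_refl] at h₅
      exact h₁.not_le (h₄.trans h₅)
  · exact h₂.not_le (h₃.trans h₄)

theorem Cover.exists_edge {μ ν : O} (h : R.Cover μ ν) : ∃ β, R.Edge β μ ν := by
  obtain ⟨h, hn⟩ := h
  cases h with
  | single h => exact h
  | tail h h' => exact absurd ⟨_, h, .single h'⟩ hn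

theorem sgn_le_cast {s t : SignType} (h : s ≤ t) : (s : ℚ) ≤ (t : ℚ) := by
  revert h
  cases s <;> cases t <;> simp

/-- Every edge has degree at least one, because the sign at a descent does not increase along the
edge, so the degree does not increase under the reflection. -/
theorem one_le_deg {β : B} {μ ν : O} (hβ : R.Edge β μ ν) : 1 ≤ R.deg β μ := by
  induction hn : R.height β using Nat.strong_induction_on generalizing β μ ν with
  | _ n ih =>
    obtain ⟨i, hi⟩ := R.exists_desc _ _ _ hβ
    by_cases hs : β = R.simple i
    · subst hs
      exact (R.deg_simple _ _ _ hβ).ge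
    · have h₁ := ih _ (hn ▸ R.height_lt _ _ _ _ hβ hs hi) (R.edge_act _ _ _ _ hβ hs) rfl
      rw [R.deg_act _ _ _ _ hβ hs] at h₁
      have h₂ := sgn_le_cast (R.sgn_le _ _ _ _ hβ hi).1
      linarith

/-- An induction principle for edges of degree one, by descent to a simple label. -/
theorem deg_one_induction {Q : B → O → O → Prop}
    (simple : ∀ i μ ν, R.Edge (R.simple i) μ ν → Q (R.simple i) μ ν)
    (step : ∀ i β μ ν, R.Edge β μ ν → R.deg β μ = 1 → β ≠ R.simple i → R.Desc i β →
      R.sgn i μ = R.sgn i ν → R.sgn i μ ≠ 0 → Q (R.act i β) (R.refl i μ) (R.refl i ν) → Q β μ ν)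
    {β : B} {μ ν : O} (hβ : R.Edge β μ ν) (hd : R.deg β μ = 1) : Q β μ ν := by
  induction hn : R.height β using Nat.strong_induction_on generalizing β μ ν with
  | _ n ih =>
    obtain ⟨i, hi⟩ := R.exists_desc _ _ _ hβ
    by_cases hs : β = R.simple i
    · subst hs
      exact simple _ _ _ hβ
    · have h₁ := one_le_deg (R.edge_act _ _ _ _ hβ hs)
      have h₃ := R.deg_act _ _ _ _ hβ hs
      obtain ⟨h₂, h₂'⟩ := R.sgn_le _ _ _ _ hβ hi
      have h₄ := sgn_le_cast h₂
      have heq : R.sgn i μ = R.sgn i ν := by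
        have : (R.sgn i μ : ℚ) = (R.sgn i ν : ℚ) := by linarith
        revert this
        cases R.sgn i μ <;> cases R.sgn i ν <;> norm_num
      have hd' : R.deg (R.act i β) (R.refl i μ) = 1 := by rw [h₃, hd, heq]; ring
      exact step i β μ ν hβ hd hs hi heq (fun h0 => h₂' h0 (heq ▸ h0))
        (ih _ (hn ▸ R.height_lt _ _ _ _ hβ hs hi) (R.edge_act _ _ _ _ hβ hs) hd' rfl)

/-- By descent: a simple edge is a cover, and `Cover.refl` lifts covers back up. -/
theorem cover_of_deg_eq_one {β : B} {μ ν : O} (hβ : R.Edge β μ ν) (hd : R.deg β μ = 1) :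
    R.Cover μ ν := by
  suffices h : R.Cover μ ν ∧ R.Edge β μ ν from h.1
  refine deg_one_induction (Q := fun β μ ν => R.Cover μ ν ∧ R.Edge β μ ν)
    (fun i μ ν h => ⟨cover_simple h, h⟩) ?_ hβ hd
  rintro i β μ ν hβ hd hs hi heq hne ⟨ih, hβ'⟩
  refine ⟨?_, hβ⟩
  -- the reflected edge is labeled by `simple i` only if its ends have opposite signs
  have hs' : R.act i β ≠ R.simple i := fun h => by
    rw [h] at hβ'
    obtain ⟨h₁, h₂⟩ := (R.edge_simple _ _ _).1 hβ'
    rw [R.refl_refl] at h₂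
    have h₃ := R.sgn_refl i ν
    rw [h₂, heq] at h₃
    rw [heq] at hne
    revert h₃ hne
    cases R.sgn i ν <;> decide
  have := ih.refl hβ' hs' (by rw [R.sgn_refl, R.sgn_refl, heq])
    (by rw [R.sgn_refl]; intro h; apply hne; revert h; cases R.sgn i μ <;> decide)
  rwa [R.refl_refl, R.refl_refl] at this

/-- By descent: along a non-simple cover the two signs at a descent `i` agree and are nonzero, so
reflecting preserves both the cover and the degree. -/
theorem Cover.deg_eq_one {β : B} {μ ν : O} (h : R.Cover μ ν) (hβ : R.Edge β μ ν) :
    R.deg β μ = 1 := by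
  induction hn : R.height β using Nat.strong_induction_on generalizing β μ ν with
  | _ n ih =>
    obtain ⟨i, hi⟩ := R.exists_desc _ _ _ hβ
    by_cases hs : β = R.simple i
    · subst hs
      exact R.deg_simple _ _ _ hβ
    · obtain ⟨h₂, h₂'⟩ := R.sgn_le _ _ _ _ hβ hi
      have h₃ : R.sgn i μ = 1 → ¬ R.sgn i ν ≤ 0 := fun h₄ h₅ =>
        hs (h.eq_simple_of_sgn_pos hβ h₄ h₅)
      have h₄ : 0 ≤ R.sgn i μ → R.sgn i ν ≠ -1 := fun h₄ h₅ =>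
        hs (h.eq_simple_of_sgn_neg hβ h₄ h₅)
      have h₅ : R.sgn i μ = R.sgn i ν ∧ R.sgn i μ ≠ 0 := by
        revert h₂ h₂' h₃ h₄
        cases R.sgn i μ <;> cases R.sgn i ν <;> decide
      have h₆ := ih _ (hn ▸ R.height_lt _ _ _ _ hβ hs hi) (h.refl hβ hs h₅.1 h₅.2)
        (R.edge_act _ _ _ _ hβ hs) rfl
      rw [R.deg_act _ _ _ _ hβ hs, h₅.1] at h₆
      linarith

end ReflectionOrder

open Module RootPairing

variable {ι V V' : Type*} [AddCommGroup V] [Module ℚ V] [AddCommGroup V'] [Module ℚ V']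
  {P : RootPairing ι ℚ V V'}

section WeylGroup

/-! ### The finite Weyl group and its length function -/

theorem weylGroup_ext {u w : P.weylGroup} (h : ∀ x : V, u • x = w • x) : u = w :=
  Subtype.ext (Equiv.weightHom_injective P (LinearEquiv.ext h))

theorem smul_root (w : P.weylGroup) (i : ι) : w • P.root i = P.root (w • i) :=
  P.weylGroup_apply_root w i

theorem ofIdx_smul_eq (i : ι) (x : V) :
    weylGroup.ofIdx P i • x = x - P.toLinearMap x (P.coroot i) • P.root i := by
  rw [weylGroup.ofIdx_smul, Equiv.reflection_smul, RootPairing.reflection_apply]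
  rfl

theorem ofIdx_smul_idx (i j : ι) : weylGroup.ofIdx P i • j = P.reflectionPerm i j := rfl

theorem ofIdx_smul_self_smul (i : ι) (x : V) :
    weylGroup.ofIdx P i • weylGroup.ofIdx P i • x = x := by
  simp

theorem ofIdx_mul_self (i : ι) : weylGroup.ofIdx P i * weylGroup.ofIdx P i = 1 :=
  weylGroup_ext fun x => by rw [mul_smul, ofIdx_smul_self_smul, one_smul]

theorem ofIdx_inv (i : ι) : (weylGroup.ofIdx P i)⁻¹ = weylGroup.ofIdx P i :=
  inv_eq_of_mul_eq_one_left (ofIdx_mul_self i)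

theorem ofIdx_mul_cancel (i : ι) (w : P.weylGroup) :
    weylGroup.ofIdx P i * (weylGroup.ofIdx P i * w) = w := by
  rw [← mul_assoc, ofIdx_mul_self, one_mul]

theorem mul_ofIdx_cancel (i : ι) (w : P.weylGroup) :
    w * weylGroup.ofIdx P i * weylGroup.ofIdx P i = w := by
  rw [mul_assoc, ofIdx_mul_self, mul_one]

theorem toLinearMap_smul_coroot_smul (w : P.weylGroup) (x : V) (i : ι) :
    P.toLinearMap (w • x) (P.coroot (w • i)) = P.toLinearMap x (P.coroot i) := by
  have h := LinearMap.congr_fun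
    (Hom.weight_coweight_transpose_apply P P (P.coroot (w • i)) w.1.toHom) x
  have h' : w.1.toHom.coweightMap (P.coroot (w • i)) = P.coroot i := by
    rw [Hom.coroot_coweightMap_apply]
    congr 1
    exact w.1.indexEquiv.symm_apply_apply i
  rw [← h']
  have h'' : P.toLinearMap x (w.1.toHom.coweightMap (P.coroot (w • i))) =
      P.toLinearMap (w.1.toHom.weightMap x) (P.coroot (w • i)) := by simpa using h.symm
  exact h''.symm

theorem toLinearMap_smul_coroot (w : P.weylGroup) (x : V) (i : ι) :
    P.toLinearMap (w • x) (P.coroot i) = P.toLinearMap x (P.coroot (w⁻¹ • i)) := by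
  rw [← toLinearMap_smul_coroot_smul w x, smul_inv_smul]

theorem ofIdx_smul_idx_eq_conj (w : P.weylGroup) (i : ι) :
    weylGroup.ofIdx P (w • i) = w * weylGroup.ofIdx P i * w⁻¹ :=
  weylGroup_ext fun x => by
    rw [mul_smul, mul_smul, ofIdx_smul_eq, ofIdx_smul_eq, smul_sub, smul_inv_smul, smul_comm,
      smul_root, ← toLinearMap_smul_coroot_smul w⁻¹, inv_smul_smul]

theorem mul_ofIdx (w : P.weylGroup) (i : ι) :
    w * weylGroup.ofIdx P i = weylGroup.ofIdx P (w • i) * w := by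
  rw [ofIdx_smul_idx_eq_conj, inv_mul_cancel_right]

theorem ofIdx_mul (w : P.weylGroup) (i : ι) :
    weylGroup.ofIdx P i * w = w * weylGroup.ofIdx P (w⁻¹ • i) := by
  rw [mul_ofIdx, smul_inv_smul]

/-- The index of the negative of a root. -/
def negIdx (P : RootPairing ι ℚ V V') (i : ι) : ι := P.reflectionPerm i i

theorem root_negIdx (i : ι) : P.root (negIdx P i) = -P.root i := by
  rw [negIdx, root_reflectionPerm, RootPairing.reflection_apply_self]

theorem negIdx_negIdx (i : ι) : negIdx P (negIdx P i) = i :=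
  P.root.injective (by rw [root_negIdx, root_negIdx, neg_neg])

theorem coroot_negIdx (i : ι) : P.coroot (negIdx P i) = -P.coroot i := by
  rw [negIdx, coroot_reflectionPerm, coreflection_apply_self]

theorem smul_negIdx (w : P.weylGroup) (i : ι) : w • negIdx P i = negIdx P (w • i) :=
  P.root.injective (by rw [← smul_root, root_negIdx, root_negIdx, smul_neg, smul_root])

theorem isPos_negIdx {b : P.Base} {i : ι} : b.IsPos (negIdx P i) ↔ ¬ b.IsPos i :=
  Base.IsPos.neg_iff_not b i

theorem ofIdx_negIdx (i : ι) : weylGroup.ofIdx P (negIdx P i) = weylGroup.ofIdx P i :=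
  weylGroup_ext fun x => by
    rw [ofIdx_smul_eq, ofIdx_smul_eq, root_negIdx, coroot_negIdx]
    simp

theorem ofIdx_smul_self (i : ι) : weylGroup.ofIdx P i • i = negIdx P i := rfl

theorem ofIdx_smul_smul (i j : ι) : weylGroup.ofIdx P i • weylGroup.ofIdx P i • j = j := by
  rw [smul_smul, ofIdx_mul_self, one_smul]

variable [Finite ι] [P.IsCrystallographic] [P.IsReduced]

omit [Finite ι] [P.IsCrystallographic] in
theorem eq_of_smul_root_eq_smul_root {i j : ι} {c d : ℚ} (hc : 0 < c) (hd : 0 < d)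
    (h : c • P.root i = d • P.root j) : i = j := by
  by_contra hij
  by_cases hneg : P.root i = -P.root j
  · rw [hneg, smul_neg, eq_comm, eq_neg_iff_add_eq_zero, ← add_smul] at h
    exact smul_ne_zero (by positivity) (P.ne_zero j) h
  · have := LinearIndependent.pair_iff.1 (IsReduced.linearIndependent P hij hneg) c (-d)
      (by rw [h, neg_smul, add_neg_cancel])
    exact hc.ne' this.1

theorem isPos_ofIdx_smul {b : P.Base} {i j : ι} (hi : i ∈ b.support) (hj : b.IsPos j)
    (hij : j ≠ i) : b.IsPos (weylGroup.ofIdx P i • j) :=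
  hj.reflectionPerm hi hij

theorem isPos_ofIdx_smul_iff {b : P.Base} {i j : ι} (hi : i ∈ b.support)
    (hij : j ≠ i) (hij' : j ≠ negIdx P i) :
    b.IsPos (weylGroup.ofIdx P i • j) ↔ b.IsPos j := by
  refine ⟨fun h => ?_, fun h => isPos_ofIdx_smul hi h hij⟩
  have := isPos_ofIdx_smul hi h (fun h' => hij' ?_)
  · rwa [ofIdx_smul_smul] at this
  · rw [← ofIdx_smul_smul (P := P) i j, h', ofIdx_smul_self]

/-- The strong exchange property: if a word sends the positive root `j` to a negative root, then
multiplying by `r_j` on the right amounts to deleting a letter. -/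
theorem exists_list_of_not_isPos (b : P.Base) (l : List b.support) {j : ι} (hj : b.IsPos j)
    (h : ¬ b.IsPos ((l.map fun i : b.support => weylGroup.ofIdx P i).prod • j)) :
    ∃ l' : List b.support, l'.length + 1 = l.length ∧
      (l'.map fun i : b.support => weylGroup.ofIdx P i).prod =
        (l.map fun i : b.support => weylGroup.ofIdx P i).prod * weylGroup.ofIdx P j := by
  induction l with
  | nil => simp [hj] at h
  | cons i t ih =>
    rw [List.map_cons, List.prod_cons] at h ⊢
    by_cases ht : b.IsPos ((t.map fun i : b.support => weylGroup.ofIdx P i).prod • j)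
    · have hi : (t.map fun i : b.support => weylGroup.ofIdx P i).prod • j = i := by
        by_contra hne
        rw [mul_smul] at h
        exact h (isPos_ofIdx_smul i.2 ht hne)
      refine ⟨t, rfl, ?_⟩
      rw [mul_assoc, mul_ofIdx, hi, ofIdx_mul_cancel]
    · obtain ⟨l', hl, hl'⟩ := ih ht
      exact ⟨i :: l', by simp [hl], by rw [List.map_cons, List.prod_cons, hl', mul_assoc]⟩

/-- The simple reflections generate the Weyl group. -/
theorem exists_list_prod_eq (b : P.Base) (w : P.weylGroup) :
    ∃ l : List b.support, (l.map fun i : b.support => weylGroup.ofIdx P i).prod = w := by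
  obtain ⟨w, hw⟩ := w
  induction hw using weylGroup.induction with
  | one => exact ⟨[], rfl⟩
  | mul x y hx hy ihx ihy =>
    obtain ⟨l, hl⟩ := ihx
    obtain ⟨l', hl'⟩ := ihy
    exact ⟨l ++ l', by rw [List.map_append, List.prod_append, hl, hl']; rfl⟩
  | mem i =>
    change ∃ l : List b.support,
      (l.map fun i : b.support => weylGroup.ofIdx P i).prod = weylGroup.ofIdx P i
    refine b.induction_reflect i (p := fun j => ∃ l : List b.support,
      (l.map fun i : b.support => weylGroup.ofIdx P i).prod = weylGroup.ofIdx P j)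
      (fun j h => ?_) (fun j hj => ⟨[⟨j, hj⟩], by simp⟩) ?_
    · change ∃ l : List b.support,
        (l.map fun i : b.support => weylGroup.ofIdx P i).prod = weylGroup.ofIdx P (negIdx P j)
      rwa [ofIdx_negIdx]
    · rintro j k ⟨l, hl⟩ hk
      refine ⟨⟨k, hk⟩ :: l ++ [⟨k, hk⟩], ?_⟩
      rw [← ofIdx_smul_idx, ofIdx_smul_idx_eq_conj, ofIdx_inv]
      rw [List.map_append, List.prod_append, List.map_cons, List.prod_cons, hl]
      simp

omit [Finite ι] [P.IsCrystallographic] [P.IsReduced] in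
/-- The list of simple indices in the definition of `len` is coerced to a list of indices before
mapping; here the coercion is applied letter by letter. -/
theorem len_eq_sInf (b : P.Base) (w : P.weylGroup) :
    len b w = sInf {n | ∃ l : List b.support, l.length = n ∧
      (l.map fun i : b.support => weylGroup.ofIdx P i).prod = w} := by
  have h (l : List b.support) : (do let a ← l; pure (a : ι)) = l.map Subtype.val := by
    simp [List.map_eq_flatMap]
  simp only [len, h, List.map_map]
  rfl

theorem exists_list_len (b : P.Base) (w : P.weylGroup) :
    ∃ l : List b.support, l.length = len b w ∧
      (l.map fun i : b.support => weylGroup.ofIdx P i).prod = w := by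
  obtain ⟨l, hl⟩ := exists_list_prod_eq b w
  rw [len_eq_sInf]
  exact Nat.sInf_mem (s := {n | ∃ l : List b.support, l.length = n ∧
    (l.map fun i : b.support => weylGroup.ofIdx P i).prod = w}) ⟨_, l, rfl, hl⟩

omit [Finite ι] [P.IsCrystallographic] [P.IsReduced] in
theorem len_le (b : P.Base) {w : P.weylGroup} (l : List b.support)
    (hl : (l.map fun i : b.support => weylGroup.ofIdx P i).prod = w) : len b w ≤ l.length := by
  rw [len_eq_sInf]
  exact Nat.sInf_le ⟨l, rfl, hl⟩

theorem len_ofIdx_mul_le {b : P.Base} {i : ι} (hi : i ∈ b.support) (w : P.weylGroup) :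
    len b (weylGroup.ofIdx P i * w) ≤ len b w + 1 := by
  obtain ⟨l, hl, hl'⟩ := exists_list_len b w
  rw [← hl]
  exact len_le b (⟨i, hi⟩ :: l) (by rw [List.map_cons, List.prod_cons, hl'])

theorem len_mul_ofIdx_lt {b : P.Base} {w : P.weylGroup} {j : ι} (hj : b.IsPos j)
    (h : ¬ b.IsPos (w • j)) : len b (w * weylGroup.ofIdx P j) < len b w := by
  obtain ⟨l, hl, hl'⟩ := exists_list_len b w
  obtain ⟨m, hm, hm'⟩ := exists_list_of_not_isPos b l hj (by rwa [hl'])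
  rw [hl'] at hm'
  have := len_le b m hm'
  omega

theorem lt_len_mul_ofIdx {b : P.Base} {w : P.weylGroup} {j : ι} (hj : b.IsPos j)
    (h : b.IsPos (w • j)) : len b w < len b (w * weylGroup.ofIdx P j) := by
  have := len_mul_ofIdx_lt (w := w * weylGroup.ofIdx P j) hj
    (by rw [mul_smul, ofIdx_smul_self, smul_negIdx, isPos_negIdx]; exact not_not.2 h)
  rwa [mul_ofIdx_cancel] at this

theorem len_ofIdx_mul_lt {b : P.Base} {w : P.weylGroup} {j : ι} (hj : b.IsPos j)
    (h : ¬ b.IsPos (w⁻¹ • j)) : len b (weylGroup.ofIdx P j * w) < len b w := by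
  have := len_mul_ofIdx_lt (w := w) (isPos_negIdx.2 h)
    (by rw [smul_negIdx, smul_inv_smul, isPos_negIdx]; exact not_not.2 hj)
  rwa [ofIdx_negIdx, ← ofIdx_mul] at this

theorem lt_len_ofIdx_mul {b : P.Base} {w : P.weylGroup} {j : ι} (hj : b.IsPos j)
    (h : b.IsPos (w⁻¹ • j)) : len b w < len b (weylGroup.ofIdx P j * w) := by
  have := lt_len_mul_ofIdx (w := w) h (by rwa [smul_inv_smul])
  rwa [← ofIdx_mul] at this

theorem len_ofIdx_mul_of_isPos {b : P.Base} {w : P.weylGroup} {i : ι} (hi : i ∈ b.support)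
    (h : b.IsPos (w⁻¹ • i)) : len b (weylGroup.ofIdx P i * w) = len b w + 1 :=
  le_antisymm (len_ofIdx_mul_le hi w) (lt_len_ofIdx_mul (Base.isPos_of_mem_support hi) h)

theorem len_ofIdx_mul_of_not_isPos {b : P.Base} {w : P.weylGroup} {i : ι} (hi : i ∈ b.support)
    (h : ¬ b.IsPos (w⁻¹ • i)) : len b (weylGroup.ofIdx P i * w) + 1 = len b w := by
  refine le_antisymm (len_ofIdx_mul_lt (Base.isPos_of_mem_support hi) h) ?_
  have := len_ofIdx_mul_le hi (weylGroup.ofIdx P i * w)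
  rwa [ofIdx_mul_cancel] at this

theorem exists_ofIdx_mul_of_len_pos {b : P.Base} {w : P.weylGroup} (h : len b w ≠ 0) :
    ∃ i ∈ b.support, ∃ u, w = weylGroup.ofIdx P i * u ∧ len b w = len b u + 1 := by
  obtain ⟨l, hl, hl'⟩ := exists_list_len b w
  cases l with
  | nil => exact absurd hl.symm h
  | cons i t =>
    rw [List.map_cons, List.prod_cons] at hl'
    refine ⟨i, i.2, _, hl'.symm, ?_⟩
    have h₁ := len_le b t rfl
    have h₂ := len_ofIdx_mul_le i.2 (t.map fun i : b.support => weylGroup.ofIdx P i).prod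
    rw [hl'] at h₂
    rw [List.length_cons] at hl
    omega

theorem eq_one_of_len_eq_zero {b : P.Base} {w : P.weylGroup} (h : len b w = 0) : w = 1 := by
  obtain ⟨l, hl, hl'⟩ := exists_list_len b w
  rw [h, List.length_eq_zero_iff] at hl
  rw [← hl', hl]
  rfl

/-! ### Covers of the Bruhat order -/

/-- The sign of `u⁻¹ α_i`, for a simple root `α_i`. -/
noncomputable def weylSgn (b : P.Base) (i : b.support) (u : P.weylGroup) : SignType :=
  open Classical in if b.IsPos (u⁻¹ • (i : ι)) then 1 else -1

theorem len_ofIdx_mul_eq (b : P.Base) (i : b.support) (u : P.weylGroup) :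
    (len b (weylGroup.ofIdx P i * u) : ℚ) = len b u + (weylSgn b i u : ℚ) := by
  unfold weylSgn
  split_ifs with h
  · rw [len_ofIdx_mul_of_isPos i.2 h]; simp
  · rw [← len_ofIdx_mul_of_not_isPos i.2 h]; simp

omit [Finite ι] [P.IsReduced] in
theorem height_ofIdx_smul (b : P.Base) (i j : ι) :
    b.height (weylGroup.ofIdx P i • j) = b.height j - P.pairingIn ℤ j i * b.height i := by
  have h : P.root (weylGroup.ofIdx P i • j) = P.root j + (-P.pairingIn ℤ j i) • P.root i := by
    rw [ofIdx_smul_idx, root_reflectionPerm, neg_smul, reflection_apply_root' ℤ, sub_eq_add_neg]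
  rw [b.height_add_zsmul h, smul_eq_mul]
  ring

omit [Finite ι] [P.IsReduced] in
/-- If `u⁻¹ j` is positive, `⟨α_i^∨, j⟩ > 0`, and `u⁻¹ α_i` is negative, then `(r_j u)⁻¹ α_i` is
negative, too. -/
theorem isPos_of_isPos_ofIdx_smul {b : P.Base} {i j : ι} {u : P.weylGroup}
    (hij : 0 < P.pairingIn ℤ i j) (hj : b.IsPos (u⁻¹ • j))
    (h : b.IsPos ((weylGroup.ofIdx P j * u)⁻¹ • i)) : b.IsPos (u⁻¹ • i) := by
  have h' : P.root ((weylGroup.ofIdx P j * u)⁻¹ • i) =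
      P.root (u⁻¹ • i) + (-P.pairingIn ℤ i j) • P.root (u⁻¹ • j) := by
    rw [mul_inv_rev, ofIdx_inv, mul_smul, ← smul_root, ofIdx_smul_idx, root_reflectionPerm,
      reflection_apply_root' ℤ, smul_sub, smul_root, smul_comm, smul_root, neg_smul, sub_eq_add_neg]
  rw [Base.isPos_iff] at *
  rw [b.height_add_zsmul h', smul_eq_mul] at h
  nlinarith

/-- The Weyl group with its Bruhat order: an edge `u → r_j u` for each positive root `j` with
`u⁻¹ j` positive, of degree the difference of the lengths. -/
noncomputable def bruhatOrder (b : P.Base) : ReflectionOrder b.support P.weylGroup ι where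
  refl i u := weylGroup.ofIdx P i * u
  act i j := weylGroup.ofIdx P i • j
  simple i := i
  Edge j u v := b.IsPos j ∧ b.IsPos (u⁻¹ • j) ∧ v = weylGroup.ofIdx P j * u
  sgn := weylSgn b
  rank u := len b u
  height j := (b.height j).toNat
  Desc i j := 0 < P.pairingIn ℤ i j
  deg j u := len b (weylGroup.ofIdx P j * u) - len b u
  refl_refl i u := ofIdx_mul_cancel _ u
  sgn_refl i u := by
    unfold weylSgn
    rw [mul_inv_rev, ofIdx_inv, mul_smul, ofIdx_smul_self, smul_negIdx, isPos_negIdx]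
    split_ifs <;> simp_all
  refl_of_sgn_eq_zero i u h := by
    unfold weylSgn at h
    split_ifs at h
  edge_simple i u v := by
    unfold weylSgn
    have := Base.isPos_of_mem_support i.2
    split_ifs with h <;> simp_all
  edge_act i j u v h hs := by
    obtain ⟨h₁, h₂, rfl⟩ := h
    refine ⟨isPos_ofIdx_smul i.2 h₁ hs, ?_, ?_⟩
    · rwa [mul_inv_rev, ofIdx_inv, mul_smul, ofIdx_smul_smul]
    · rw [ofIdx_smul_idx_eq_conj, ofIdx_inv, mul_assoc, ofIdx_mul_cancel, mul_assoc]
  edge_unique i j u v h h' := by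
    obtain ⟨h₁, -, rfl⟩ := h
    obtain ⟨h₂, -, h₃⟩ := h'
    have h₄ : weylGroup.ofIdx P i • P.root i = weylGroup.ofIdx P j • P.root i := by
      rw [mul_right_cancel h₃]
    rw [ofIdx_smul_eq, ofIdx_smul_eq, root_coroot_two, sub_right_inj] at h₄
    rcases lt_trichotomy (P.toLinearMap (P.root i) (P.coroot j)) 0 with h₅ | h₅ | h₅
    · have := eq_of_smul_root_eq_smul_root (P := P) (i := i) (j := negIdx P j) two_pos
        (neg_pos.2 h₅) (by rw [h₄, root_negIdx, smul_neg, neg_smul, neg_neg])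
      rw [this, isPos_negIdx] at h₁
      exact absurd h₂ h₁
    · rw [h₅, zero_smul] at h₄
      exact absurd h₄ (smul_ne_zero two_ne_zero (P.ne_zero i))
    · exact eq_of_smul_root_eq_smul_root two_pos h₅ h₄
  rank_lt j u v h := by
    obtain ⟨h₁, h₂, rfl⟩ := h
    exact_mod_cast lt_len_ofIdx_mul h₁ h₂
  exists_desc j u v h := by
    obtain ⟨i, hi, h'⟩ := h.1.exists_mem_support_pos_pairingIn
    exact ⟨⟨i, hi⟩, h'⟩
  height_lt i j u v h hs hd := by
    have h₁ := isPos_ofIdx_smul i.2 h.1 hs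
    have h₂ := height_ofIdx_smul b i j
    have h₃ := (P.zero_lt_pairingIn_iff' ℤ).1 hd
    rw [Base.height_one_of_mem_support i.2] at h₂
    rw [Base.isPos_iff] at h₁
    rw [mul_one] at h₂
    omega
  sgn_le i j u v h hd := by
    obtain ⟨h₁, h₂, rfl⟩ := h
    have := isPos_of_isPos_ofIdx_smul (b := b) (i := i) (u := u) hd h₂
    unfold weylSgn
    split_ifs <;> simp_all
  deg_simple i u v h := by
    obtain ⟨h₁, h₂, rfl⟩ := h
    rw [len_ofIdx_mul_of_isPos i.2 h₂]
    simp
  deg_act i j u v h hs := by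
    obtain ⟨h₁, h₂, rfl⟩ := h
    rw [ofIdx_smul_idx_eq_conj, ofIdx_inv, mul_assoc, ofIdx_mul_cancel, mul_assoc, len_ofIdx_mul_eq,
      len_ofIdx_mul_eq]
    ring

end WeylGroup

section Dominance

/-! ### Heights and dominance -/

/-- The linear functional that takes the value one at every simple root. -/
noncomputable def htFun [P.IsRootSystem] (b : P.Base) : V →ₗ[ℚ] ℚ :=
  b.toWeightBasis.constr ℚ fun _ => (1 : ℚ)

theorem htFun_simple [P.IsRootSystem] (b : P.Base) {i : ι} (hi : i ∈ b.support) :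
    htFun b (P.root i) = 1 := by
  have := b.toWeightBasis.constr_basis ℚ (fun _ => (1 : ℚ)) ⟨i, hi⟩
  rwa [Base.toWeightBasis_apply] at this

theorem htFun_root [P.IsRootSystem] (b : P.Base) (i : ι) : htFun b (P.root i) = b.height i := by
  obtain ⟨f, -, -, hf⟩ := b.exists_root_eq_sum_int i
  rw [Base.height_eq_sum hf, hf, map_sum, Int.cast_sum]
  refine Finset.sum_congr rfl fun j hj => ?_
  rw [map_zsmul, htFun_simple b hj]
  simp

theorem htFun_nonneg_of_mem_closure [P.IsRootSystem] {b : P.Base} {v : V}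
    (hv : v ∈ AddSubmonoid.closure (P.root '' b.support)) : 0 ≤ htFun b v := by
  induction hv using AddSubmonoid.closure_induction with
  | mem x hx => obtain ⟨i, hi, rfl⟩ := hx; rw [htFun_simple b hi]; exact zero_le_one
  | zero => rw [map_zero]
  | add x y _ _ hx hy => rw [map_add]; exact add_nonneg hx hy

theorem eq_zero_of_mem_closure [P.IsRootSystem] {b : P.Base} {v : V}
    (hv : v ∈ AddSubmonoid.closure (P.root '' b.support)) (h : htFun b v = 0) : v = 0 := by
  induction hv using AddSubmonoid.closure_induction with
  | mem x hx => obtain ⟨i, hi, rfl⟩ := hx; rw [htFun_simple b hi] at h; exact absurd h one_ne_zero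
  | zero => rfl
  | add x y h₁ h₂ hx hy =>
    rw [map_add] at h
    have h₃ := htFun_nonneg_of_mem_closure h₁
    have h₄ := htFun_nonneg_of_mem_closure h₂
    rw [hx (by linarith), hy (by linarith), add_zero]

theorem isPos_iff_htFun_pos [P.IsRootSystem] {b : P.Base} {i : ι} :
    b.IsPos i ↔ 0 < htFun b (P.root i) := by
  rw [htFun_root, Base.isPos_iff, Int.cast_pos]

theorem isPos_iff_mem_closure [P.IsRootSystem] {b : P.Base} {i : ι} :
    b.IsPos i ↔ P.root i ∈ AddSubmonoid.closure (P.root '' b.support) := by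
  rw [Base.isPos_iff']
  constructor
  · intro h
    refine (b.root_mem_or_neg_mem i).resolve_right fun h' => ?_
    have h₁ := htFun_nonneg_of_mem_closure h'
    rw [map_neg, htFun_root] at h₁
    have h₂ : (0 : ℚ) ≤ b.height i := by exact_mod_cast h
    exact P.ne_zero i (neg_eq_zero.1 (eq_zero_of_mem_closure h' (by
      rw [map_neg, htFun_root]; linarith)))
  · intro h
    have := htFun_nonneg_of_mem_closure h
    rw [htFun_root] at this
    exact_mod_cast this

variable [Fintype ι] [P.IsCrystallographic] [P.IsReduced]

omit [P.IsCrystallographic] [P.IsReduced] in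
theorem rootForm_mul_coroot (i : ι) (x : V) :
    P.RootForm (P.root i) (P.root i) * P.toLinearMap x (P.coroot i) =
      2 * P.RootForm (P.root i) x := by
  have h := congrArg (P.toLinearMap x) (P.rootForm_self_smul_coroot i)
  rw [map_smul, smul_eq_mul, map_nsmul, toLinearMap_apply_apply_Polarization] at h
  rw [h, nsmul_eq_mul, Nat.cast_ofNat]

omit [P.IsCrystallographic] [P.IsReduced] in
theorem rootForm_root_self_pos (i : ι) : 0 < P.RootForm (P.root i) (P.root i) := by
  rw [P.rootForm_root_self]
  refine Finset.sum_pos' (fun j _ => mul_self_nonneg _) ⟨i, Finset.mem_univ _, ?_⟩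
  rw [pairing_same]
  norm_num

omit [P.IsCrystallographic] [P.IsReduced] in
theorem coroot_nonneg_iff {i : ι} {x : V} :
    0 ≤ P.toLinearMap x (P.coroot i) ↔ 0 ≤ P.RootForm (P.root i) x := by
  have h := rootForm_mul_coroot (P := P) i x
  have h' := rootForm_root_self_pos (P := P) i
  constructor
  · intro h₁
    have := mul_nonneg h'.le h₁
    linarith
  · intro h₁
    by_contra! h₂
    have := mul_neg_of_pos_of_neg h' h₂
    linarith

omit [P.IsCrystallographic] [P.IsReduced] in
theorem coroot_eq_zero_iff {i : ι} {x : V} :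
    P.toLinearMap x (P.coroot i) = 0 ↔ P.RootForm (P.root i) x = 0 := by
  have h := rootForm_mul_coroot (P := P) i x
  have h' := rootForm_root_self_pos (P := P) i
  constructor
  · intro h₁
    rw [h₁] at h
    linarith
  · intro h₁
    rw [h₁, mul_zero, mul_eq_zero] at h
    exact h.resolve_left h'.ne'

omit [P.IsCrystallographic] [P.IsReduced] [Fintype ι] in
theorem exists_root_eq_sum_of_isPos {b : P.Base} {i : ι} (hi : b.IsPos i) :
    ∃ f : ι → ℤ, (∀ j, 0 ≤ f j) ∧ P.root i = ∑ j ∈ b.support, f j • P.root j := by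
  obtain ⟨f, -, hf, hf'⟩ := b.exists_root_eq_sum_int i
  refine ⟨f, fun j => ?_, hf'⟩
  rcases hf with hf | hf
  · exact hf.le j
  · rw [Base.isPos_iff, Base.height_eq_sum hf'] at hi
    exact absurd hi (not_lt.2 (Finset.sum_nonpos fun j _ => hf.le j))

omit [P.IsCrystallographic] [P.IsReduced] in
theorem rootForm_simple_nonneg {b : P.Base} {lam : V} (hlam : IsDominantWeight b lam) {j : ι}
    (hj : j ∈ b.support) : 0 ≤ P.RootForm (P.root j) lam := by
  obtain ⟨n, hn⟩ := hlam j hj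
  rw [← coroot_nonneg_iff, hn]
  exact n.cast_nonneg

omit [P.IsCrystallographic] [P.IsReduced] in
theorem coroot_nonneg_of_isPos {b : P.Base} {lam : V} (hlam : IsDominantWeight b lam) {i : ι}
    (hi : b.IsPos i) : 0 ≤ P.toLinearMap lam (P.coroot i) := by
  obtain ⟨f, hf, hf'⟩ := exists_root_eq_sum_of_isPos hi
  rw [coroot_nonneg_iff, hf', map_sum, LinearMap.sum_apply]
  refine Finset.sum_nonneg fun j hj => ?_
  rw [map_zsmul, LinearMap.smul_apply]
  exact zsmul_nonneg (rootForm_simple_nonneg hlam hj) (hf j)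

omit [P.IsCrystallographic] [P.IsReduced] in
/-- The roots of `Φ⁺ \ Φ_J⁺` are those whose coroot is positive at the dominant weight. -/
theorem mem_posIdx_diff_posIdxJ_iff {b : P.Base} {lam : V} (hlam : IsDominantWeight b lam)
    {i : ι} : i ∈ posIdx b \ posIdxJ b lam ↔ 0 < P.toLinearMap lam (P.coroot i) := by
  constructor
  · rintro ⟨hi, hJ⟩
    refine lt_of_le_of_ne (coroot_nonneg_of_isPos hlam hi) fun h₀ => hJ ⟨hi, ?_⟩
    obtain ⟨f, hf, hf'⟩ := exists_root_eq_sum_of_isPos hi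
    rw [eq_comm, coroot_eq_zero_iff, hf', map_sum, LinearMap.sum_apply,
      Finset.sum_eq_zero_iff_of_nonneg] at h₀
    · rw [hf']
      refine Submodule.sum_mem _ fun j hj => ?_
      have h₁ := h₀ j hj
      rw [map_zsmul, LinearMap.smul_apply, smul_eq_zero] at h₁
      rcases h₁ with h₁ | h₁
      · rw [h₁, zero_smul]
        exact Submodule.zero_mem _
      · exact Submodule.smul_mem _ _ (Submodule.subset_span
          ⟨j, ⟨hj, coroot_eq_zero_iff.2 h₁⟩, rfl⟩)
    · intro j hj
      rw [map_zsmul, LinearMap.smul_apply]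
      exact zsmul_nonneg (rootForm_simple_nonneg hlam hj) (hf j)
  · intro h
    have hi : b.IsPos i := by
      by_contra hn
      have := coroot_nonneg_of_isPos hlam (isPos_negIdx.2 hn)
      rw [coroot_negIdx, map_neg] at this
      linarith
    refine ⟨hi, fun hJ => h.ne' (coroot_eq_zero_iff.2 ?_)⟩
    have := hJ.2
    generalize P.root i = r at this ⊢
    induction this using Submodule.span_induction with
    | mem x hx =>
      obtain ⟨j, hj, rfl⟩ := hx
      exact coroot_eq_zero_iff.1 hj.2
    | zero => simp
    | add x y _ _ hx hy => rw [map_add, LinearMap.add_apply, hx, hy, add_zero]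
    | smul c x _ hx => rw [map_zsmul, LinearMap.smul_apply, hx, smul_zero]

/-! ### Signed sums over the roots -/

/-- The sign of the pairing of `x` with a coroot. -/
noncomputable def corootSgn (P : RootPairing ι ℚ V V') (x : V) (j : ι) : ℚ :=
  (SignType.sign (P.toLinearMap x (P.coroot j)) : ℚ)

/-- The sign `±1` of a root. -/
noncomputable def rootSgn (b : P.Base) (j : ι) : ℚ :=
  open Classical in if b.IsPos j then 1 else -1

/-- The sum over all roots of the product of the sign of the root and the sign of the pairing of
`x` with its coroot. On an orbit of `W` it is, up to a constant, `-4` times the number of positive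
coroots that are negative at `x`. -/
noncomputable def signSum (b : P.Base) (x : V) : ℚ := ∑ j, rootSgn b j * corootSgn P x j

/-- The sum of all roots weighted by the signs of the pairings of `x` with their coroots. -/
noncomputable def signRoot (P : RootPairing ι ℚ V V') (x : V) : V :=
  ∑ j, corootSgn P x j • P.root j

omit [Fintype ι] [P.IsCrystallographic] [P.IsReduced] in
theorem corootSgn_smul (w : P.weylGroup) (x : V) (j : ι) :
    corootSgn P (w • x) j = corootSgn P x (w⁻¹ • j) := by
  rw [corootSgn, corootSgn, toLinearMap_smul_coroot]

omit [Fintype ι] [P.IsCrystallographic] [P.IsReduced] in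
theorem corootSgn_negIdx (x : V) (j : ι) : corootSgn P x (negIdx P j) = -corootSgn P x j := by
  rw [corootSgn, corootSgn, coroot_negIdx, map_neg, Left.sign_neg]
  simp

omit [P.IsCrystallographic] [P.IsReduced] in
theorem signRoot_smul (w : P.weylGroup) (x : V) : signRoot P (w • x) = w • signRoot P x := by
  rw [signRoot, signRoot, Finset.smul_sum, ← Equiv.sum_comp (MulAction.toPerm w)]
  refine Finset.sum_congr rfl fun j _ => ?_
  rw [MulAction.toPerm_apply, corootSgn_smul, inv_smul_smul, ← smul_root, smul_comm]

omit [P.IsCrystallographic] [P.IsReduced] in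
theorem signSum_ofIdx_smul (b : P.Base) (i : ι) (x : V) :
    signSum b (weylGroup.ofIdx P i • x) =
      signSum b x + ∑ j, (rootSgn b (weylGroup.ofIdx P i • j) - rootSgn b j) * corootSgn P x j := by
  rw [signSum, signSum, ← Finset.sum_add_distrib,
    ← Equiv.sum_comp (MulAction.toPerm (weylGroup.ofIdx P i))]
  refine Finset.sum_congr rfl fun j _ => ?_
  rw [MulAction.toPerm_apply, corootSgn_smul, inv_smul_smul]
  ring

omit [Fintype ι] [P.IsCrystallographic] [P.IsReduced] in
theorem ne_negIdx (b : P.Base) (i : ι) : i ≠ negIdx P i := fun h => by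
  have := isPos_negIdx (b := b) (i := i)
  rw [← h] at this
  tauto

theorem signSum_simple (b : P.Base) {i : ι} (hi : i ∈ b.support) (x : V) :
    signSum b (weylGroup.ofIdx P i • x) = signSum b x - 4 * corootSgn P x i := by
  classical
  have hpos := Base.isPos_of_mem_support hi
  have hne := ne_negIdx b i
  rw [signSum_ofIdx_smul, Finset.sum_eq_add (s := Finset.univ) i (negIdx P i) hne]
  · rw [corootSgn_negIdx, smul_negIdx, ofIdx_smul_self, negIdx_negIdx]
    simp only [rootSgn, isPos_negIdx, hpos, if_true, not_true, if_false]
    ring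
  · rintro j - ⟨h₁, h₂⟩
    simp only [rootSgn, isPos_ofIdx_smul_iff hi h₁ h₂, sub_self, zero_mul]
  · simp
  · simp

/-! ### The highest root -/

section HighestRoot

variable {b : P.Base} {θ : ι}

omit [Fintype ι] [P.IsCrystallographic] [P.IsReduced]

variable [P.IsRootSystem]

theorem IsHighestRoot.htFun_le (hθ : IsHighestRoot b θ) (i : ι) :
    htFun b (P.root i) ≤ htFun b (P.root θ) := by
  have := htFun_nonneg_of_mem_closure (hθ i)
  rw [map_sub] at this
  linarith

theorem IsHighestRoot.isPos (hθ : IsHighestRoot b θ) : b.IsPos θ := by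
  by_contra h
  have h₁ := isPos_iff_htFun_pos.1 (isPos_negIdx.2 h)
  have h₂ := hθ.htFun_le (negIdx P θ)
  rw [root_negIdx, map_neg] at h₁ h₂
  linarith

theorem IsHighestRoot.eq_of_htFun (hθ : IsHighestRoot b θ) {i : ι}
    (h : htFun b (P.root θ) ≤ htFun b (P.root i)) : i = θ := by
  have := eq_zero_of_mem_closure (hθ i) (by rw [map_sub]; linarith [hθ.htFun_le i])
  exact P.root.injective (sub_eq_zero.1 this).symm

theorem htFun_ofIdx_smul (b : P.Base) (i : ι) (x : V) :
    htFun b (weylGroup.ofIdx P i • x) =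
      htFun b x - P.toLinearMap x (P.coroot i) * htFun b (P.root i) := by
  rw [ofIdx_smul_eq, map_sub, map_smul, smul_eq_mul]

variable [P.IsCrystallographic]

/-- Otherwise the reflection in `i` would send `θ` to a higher root. -/
theorem IsHighestRoot.pairingIn_nonneg [Finite ι] (hθ : IsHighestRoot b θ) {i : ι}
    (hi : b.IsPos i) : 0 ≤ P.pairingIn ℤ i θ := by
  by_contra! h
  have h₁ := (P.pairingIn_lt_zero_iff ℤ).1 h
  have h₂ := hθ.htFun_le (weylGroup.ofIdx P i • θ)
  rw [← smul_root, htFun_ofIdx_smul, root_coroot_eq_pairing, ← P.algebraMap_pairingIn ℤ] at h₂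
  have h₃ := isPos_iff_htFun_pos.1 hi
  have h₄ : (algebraMap ℤ ℚ) (P.pairingIn ℤ θ i) < 0 := by simpa using h₁
  have := mul_neg_of_neg_of_pos h₄ h₃
  linarith

/-- If the pairing were at least two, then the negative of the reflection of `i` in `θ` would be a
root at least as high as `2θ - i`, hence `i = θ`. -/
theorem IsHighestRoot.pairingIn_le_one (hθ : IsHighestRoot b θ) {i : ι}
    (hne : i ≠ θ) : P.pairingIn ℤ i θ ≤ 1 := by
  by_contra! h
  have h₁ := hθ.htFun_le (negIdx P (weylGroup.ofIdx P θ • i))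
  rw [root_negIdx, ← smul_root, map_neg, htFun_ofIdx_smul, root_coroot_eq_pairing,
    ← P.algebraMap_pairingIn ℤ] at h₁
  have h₂ : (2 : ℚ) ≤ algebraMap ℤ ℚ (P.pairingIn ℤ i θ) := by
    rw [algebraMap_int_eq, eq_intCast]; exact_mod_cast h
  have h₃ := isPos_iff_htFun_pos.1 hθ.isPos
  refine hne (hθ.eq_of_htFun ?_)
  nlinarith

theorem IsHighestRoot.not_isPos_of_pairingIn (hθ : IsHighestRoot b θ) {i : ι}
    (h : 0 < P.pairingIn ℤ i θ) : ¬ b.IsPos (weylGroup.ofIdx P θ • i) := by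
  intro hp
  rw [isPos_iff_htFun_pos, ← smul_root, htFun_ofIdx_smul, root_coroot_eq_pairing,
    ← P.algebraMap_pairingIn ℤ] at hp
  have h₁ := hθ.htFun_le i
  have h₂ : (1 : ℚ) ≤ algebraMap ℤ ℚ (P.pairingIn ℤ i θ) := by
    rw [algebraMap_int_eq, eq_intCast]; exact_mod_cast h
  have h₃ := isPos_iff_htFun_pos.1 hθ.isPos
  nlinarith

omit [P.IsRootSystem] in
theorem ofIdx_smul_of_pairingIn_eq_zero {i j : ι} (h : P.pairingIn ℤ j i = 0) :
    weylGroup.ofIdx P i • j = j := by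
  refine P.root.injective ?_
  rw [← smul_root, ofIdx_smul_eq, root_coroot_eq_pairing, ← P.algebraMap_pairingIn ℤ, h, map_zero,
    zero_smul, sub_zero]

/-- The reflection in `θ` fixes the positive roots with `⟨θ^∨, α⟩ = 0` and sends those with
`⟨θ^∨, α⟩ = 1` to negative roots; `θ` itself, with pairing `2`, is the exception to
proportionality. -/
theorem IsHighestRoot.rootSgn_sub_of_isPos [Finite ι] [DecidableEq ι] (hθ : IsHighestRoot b θ)
    {j : ι} (hj : b.IsPos j) :
    rootSgn b (weylGroup.ofIdx P θ • j) - rootSgn b j =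
      -2 * P.pairing j θ + ((if j = θ then 2 else 0) - if negIdx P j = θ then 2 else 0) := by
  have hne : negIdx P j ≠ θ := fun h => by
    have := hθ.isPos
    rw [← h, isPos_negIdx] at this
    exact this hj
  rw [if_neg hne, sub_zero]
  by_cases h : j = θ
  · subst h
    simp only [rootSgn, ofIdx_smul_self, isPos_negIdx, hj, not_true, if_true, if_false,
      pairing_same]
    norm_num
  · have h₁ := hθ.pairingIn_nonneg hj
    have h₂ := hθ.pairingIn_le_one h
    rw [if_neg h, ← P.algebraMap_pairingIn ℤ]
    rcases (by omega : P.pairingIn ℤ j θ = 0 ∨ P.pairingIn ℤ j θ = 1) with h₃ | h₃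
    · rw [ofIdx_smul_of_pairingIn_eq_zero h₃, h₃]
      simp
    · have h₄ := hθ.not_isPos_of_pairingIn (by rw [h₃]; exact one_pos)
      simp only [rootSgn, hj, h₄, if_true, if_false, h₃]
      simp
      norm_num

omit [P.IsRootSystem] [P.IsCrystallographic] in
theorem rootSgn_negIdx (b : P.Base) (j : ι) : rootSgn b (negIdx P j) = -rootSgn b j := by
  have h := isPos_negIdx (b := b) (i := j)
  by_cases hj : b.IsPos j <;> simp [rootSgn, h, hj]

theorem IsHighestRoot.rootSgn_sub [Finite ι] [DecidableEq ι] (hθ : IsHighestRoot b θ) (j : ι) :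
    rootSgn b (weylGroup.ofIdx P θ • j) - rootSgn b j =
      -2 * P.pairing j θ + ((if j = θ then 2 else 0) - if negIdx P j = θ then 2 else 0) := by
  by_cases hj : b.IsPos j
  · exact hθ.rootSgn_sub_of_isPos hj
  · have h := hθ.rootSgn_sub_of_isPos (isPos_negIdx.2 hj)
    rw [smul_negIdx, rootSgn_negIdx, rootSgn_negIdx, negIdx_negIdx, ← root_coroot_eq_pairing,
      root_negIdx, map_neg, LinearMap.neg_apply, root_coroot_eq_pairing] at h
    linarith

/-- The behaviour of the signed count under the reflection in the highest root, whose coroot has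
pairing `0` or `1` with the other positive roots. -/
theorem IsHighestRoot.signSum_smul [Fintype ι] (hθ : IsHighestRoot b θ) (x : V) :
    signSum b (weylGroup.ofIdx P θ • x) =
      signSum b x + 4 * corootSgn P x θ - 2 * P.toLinearMap (signRoot P x) (P.coroot θ) := by
  classical
  have h (j : ι) : negIdx P j = θ ↔ j = negIdx P θ :=
    ⟨fun h => by rw [← h, negIdx_negIdx], fun h => by rw [h, negIdx_negIdx]⟩
  rw [signSum_ofIdx_smul, signRoot, map_sum, LinearMap.sum_apply, add_sub_assoc]
  congr 1
  simp only [hθ.rootSgn_sub, add_mul, Finset.sum_add_distrib, sub_mul, Finset.sum_sub_distrib,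
    ite_mul, zero_mul, Finset.sum_ite_eq', Finset.mem_univ, if_true, h, corootSgn_negIdx, map_smul,
    LinearMap.smul_apply, root_coroot_eq_pairing, smul_eq_mul, Finset.mul_sum]
  rw [add_comm, sub_eq_add_neg _ (∑ i, _), ← Finset.sum_neg_distrib]
  congr 1
  · ring
  · exact Finset.sum_congr rfl fun j _ => by ring

end HighestRoot

/-! ### Minimal coset representatives -/

section MinReps

variable {b : P.Base} {lam : V}

omit [Fintype ι] [P.IsCrystallographic] [P.IsReduced]

theorem inv_mul_mem_stab {u w : P.weylGroup} : u⁻¹ * w ∈ stab P lam ↔ w • lam = u • lam := by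
  rw [stab, MulAction.mem_stabilizer_iff, mul_smul, inv_smul_eq_iff]

theorem mem_minReps_iff {w : P.weylGroup} :
    w ∈ minReps b lam ↔ ∀ u : P.weylGroup, u • lam = w • lam → len b w ≤ len b u := by
  constructor
  · intro h u hu
    have := h (w⁻¹ * u) (inv_mul_mem_stab.2 hu)
    rwa [mul_inv_cancel_left] at this
  · intro h u hu
    refine h _ ?_
    rw [mul_smul]
    exact congrArg _ hu

theorem coroot_ofIdx_smul (i : ι) (x : V) :
    P.toLinearMap (weylGroup.ofIdx P i • x) (P.coroot i) = -P.toLinearMap x (P.coroot i) := by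
  rw [toLinearMap_smul_coroot, ofIdx_inv, ofIdx_smul_self, coroot_negIdx, map_neg]

theorem exists_mem_minReps (b : P.Base) (lam : V) (w : P.weylGroup) :
    ∃ u ∈ minReps b lam, u • lam = w • lam := by
  obtain ⟨u, hu, hmin⟩ := WellFounded.has_min (measure (len b)).wf
    {u : P.weylGroup | u • lam = w • lam} ⟨w, rfl⟩
  exact ⟨u, mem_minReps_iff.2 fun v hv => not_lt.1 (hmin v (hv.trans hu)), hu⟩

theorem smul_left_iff {s u w : P.weylGroup} : (s * u) • lam = (s * w) • lam ↔
    u • lam = w • lam := by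
  rw [mul_smul, mul_smul, smul_left_cancel_iff]

variable [Fintype ι] [P.IsCrystallographic] [P.IsReduced]

/-- Removing the first letter of a minimal representative. -/
theorem mem_minReps_of_len {i : ι} (hi : i ∈ b.support) {u : P.weylGroup}
    (h : weylGroup.ofIdx P i * u ∈ minReps b lam)
    (hl : len b (weylGroup.ofIdx P i * u) = len b u + 1) : u ∈ minReps b lam := by
  rw [mem_minReps_iff] at h ⊢
  intro v hv
  have h₁ := h (weylGroup.ofIdx P i * v) (smul_left_iff.2 hv)
  have h₂ := len_ofIdx_mul_le hi v
  omega

omit [P.IsCrystallographic] [P.IsReduced] in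
theorem isPos_inv_smul_of_coroot_pos (hlam : IsDominantWeight b lam) {w : P.weylGroup} {i : ι}
    (h : 0 < P.toLinearMap (w • lam) (P.coroot i)) : b.IsPos (w⁻¹ • i) := by
  rw [toLinearMap_smul_coroot] at h
  exact ((mem_posIdx_diff_posIdxJ_iff hlam).2 h).1

omit [P.IsCrystallographic] [P.IsReduced] in
theorem not_isPos_inv_smul_of_coroot_neg (hlam : IsDominantWeight b lam) {w : P.weylGroup} {i : ι}
    (h : P.toLinearMap (w • lam) (P.coroot i) < 0) : ¬ b.IsPos (w⁻¹ • i) := by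
  rw [← isPos_negIdx, ← smul_negIdx]
  refine isPos_inv_smul_of_coroot_pos hlam ?_
  rw [coroot_negIdx, map_neg]
  linarith

theorem coroot_pos_of_mem_minReps (hlam : IsDominantWeight b lam) {i : ι} (hi : i ∈ b.support)
    {u : P.weylGroup} (h : weylGroup.ofIdx P i * u ∈ minReps b lam)
    (hl : len b (weylGroup.ofIdx P i * u) = len b u + 1) :
    0 < P.toLinearMap (u • lam) (P.coroot i) := by
  by_contra! hle
  rcases hle.lt_or_eq with h₁ | h₁
  · have := len_ofIdx_mul_of_not_isPos hi (not_isPos_inv_smul_of_coroot_neg hlam h₁)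
    omega
  · have := mem_minReps_iff.1 h u (by rw [mul_smul, ofIdx_smul_eq, h₁, zero_smul, sub_zero])
    omega

/-- The length of a minimal representative `w` depends only on the weight `w λ`: each letter of a
reduced word of `w` moves the weight down, and so contributes four to the signed count. -/
theorem len_eq_of_mem_minReps (hlam : IsDominantWeight b lam) {w : P.weylGroup}
    (hw : w ∈ minReps b lam) :
    (len b w : ℚ) = (signSum b lam - signSum b (w • lam)) / 4 := by
  induction hn : len b w generalizing w with
  | zero => rw [eq_one_of_len_eq_zero hn]; simp
  | succ n ih =>
    obtain ⟨i, hi, u, rfl, hl⟩ := exists_ofIdx_mul_of_len_pos (b := b) (w := w) (by omega)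
    have h₁ := ih (mem_minReps_of_len hi hw hl) (by omega)
    have h₂ := coroot_pos_of_mem_minReps hlam hi hw hl
    rw [mul_smul, signSum_simple b hi, corootSgn, sign_pos h₂, Nat.cast_add, h₁]
    simp
    ring

theorem le_len (hlam : IsDominantWeight b lam) (w : P.weylGroup) :
    (signSum b lam - signSum b (w • lam)) / 4 ≤ len b w := by
  obtain ⟨u, hu, hu'⟩ := exists_mem_minReps b lam w
  rw [← hu', ← len_eq_of_mem_minReps hlam hu, Nat.cast_le]
  exact mem_minReps_iff.1 hu w hu'.symm

theorem minReps_unique (hlam : IsDominantWeight b lam) {u w : P.weylGroup}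
    (hu : u ∈ minReps b lam) (hw : w ∈ minReps b lam) (h : u • lam = w • lam) : u = w := by
  have hlen : len b u = len b w :=
    le_antisymm (mem_minReps_iff.1 hu _ h.symm) (mem_minReps_iff.1 hw _ h)
  induction hn : len b u generalizing u w with
  | zero => rw [eq_one_of_len_eq_zero hn, eq_one_of_len_eq_zero (hlen.symm.trans hn)]
  | succ n ih =>
    obtain ⟨i, hi, v, rfl, hl⟩ := exists_ofIdx_mul_of_len_pos (b := b) (w := u) (by omega)
    have h₁ := coroot_pos_of_mem_minReps hlam hi hu hl
    have h₂ : ¬ b.IsPos (w⁻¹ • i) := by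
      refine not_isPos_inv_smul_of_coroot_neg hlam ?_
      rw [← h, mul_smul, coroot_ofIdx_smul]
      linarith
    have h₃ := len_ofIdx_mul_of_not_isPos hi h₂
    have hv : v • lam = (weylGroup.ofIdx P i * w) • lam := by
      rw [mul_smul, ← h, mul_smul, ofIdx_smul_self_smul]
    have hw' : weylGroup.ofIdx P i * w ∈ minReps b lam :=
      mem_minReps_of_len hi (by rwa [ofIdx_mul_cancel]) (by rw [ofIdx_mul_cancel]; exact h₃.symm)
    rw [ih (mem_minReps_of_len hi hu hl) hw' hv (by omega) (by omega), ofIdx_mul_cancel]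

omit [P.IsCrystallographic] [P.IsReduced] in
/-- The sum of all roots, weighted by signs, is `4ρ - 4ρ_J` at the dominant weight. -/
theorem signRoot_eq (hlam : IsDominantWeight b lam) :
    signRoot P lam = (2 : ℚ) • ((2 : ℚ) • rho b - (2 : ℚ) • rhoJ b lam) := by
  classical
  have h₁ : rhoJ b lam = (1 / 2 : ℚ) • ∑ j, if j ∈ posIdxJ b lam then P.root j else 0 := by
    rw [rhoJ, finsum_mem_def, finsum_eq_sum_of_fintype]
    simp [Set.indicator_apply]
  have h₂ : rho b = (1 / 2 : ℚ) • ∑ j, if j ∈ posIdx b then P.root j else 0 := by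
    rw [rho, finsum_mem_def, finsum_eq_sum_of_fintype]
    simp [Set.indicator_apply]
  have h₃ : (2 : ℚ) • rho b - (2 : ℚ) • rhoJ b lam =
      ∑ j, if 0 < P.toLinearMap lam (P.coroot j) then P.root j else 0 := by
    rw [h₁, h₂, smul_smul, smul_smul, mul_one_div_cancel two_ne_zero, one_smul, one_smul,
      ← Finset.sum_sub_distrib]
    refine Finset.sum_congr rfl fun j _ => ?_
    have h₀ := mem_posIdx_diff_posIdxJ_iff hlam (i := j)
    rw [Set.mem_sdiff] at h₀
    by_cases h₄ : j ∈ posIdxJ b lam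
    · have h₅ : j ∈ posIdx b := h₄.1
      simp [h₄, h₅, ← h₀]
    · simp [h₄, ← h₀]
  have h₆ : ∑ j, (if 0 < P.toLinearMap lam (P.coroot j) then P.root j else 0) =
      ∑ j, if P.toLinearMap lam (P.coroot j) < 0 then -P.root j else 0 := by
    rw [← Equiv.sum_comp (Function.Involutive.toPerm (negIdx P) negIdx_negIdx)]
    refine Finset.sum_congr rfl fun j _ => ?_
    change (if 0 < P.toLinearMap lam (P.coroot (negIdx P j)) then P.root (negIdx P j) else 0) = _
    simp only [coroot_negIdx, root_negIdx, map_neg, neg_pos]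
  rw [two_smul, h₃]
  nth_rw 2 [h₆]
  rw [← Finset.sum_add_distrib, signRoot]
  refine Finset.sum_congr rfl fun j _ => ?_
  rcases lt_trichotomy (P.toLinearMap lam (P.coroot j)) 0 with h | h | h
  · simp [corootSgn, h, h.le]
  · simp [corootSgn, h]
  · simp [corootSgn, h, h.le]

end MinReps

end Dominance

section AffineRoots

/-! ### Affine real roots -/

/-- The affine real root `α_j + k δ`. -/
def affRoot (P : RootPairing ι ℚ V V') (l : ι × ℤ) : AffSpace V := (P.root l.1, 0, (l.2 : ℚ))

/-- Positivity of the affine real root `α_j + k δ`. -/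
def AffPos (b : P.Base) (l : ι × ℤ) : Prop := 1 ≤ l.2 ∨ l.2 = 0 ∧ b.IsPos l.1

/-- The simple affine roots as pairs `(j, k)`, standing for `α_j + k δ`. -/
def simpleLabel (b : P.Base) (θ : ι) : Option b.support → ι × ℤ
  | none => (negIdx P θ, 1)
  | some i => (i, 0)

/-- The simple affine reflections on affine real roots. -/
noncomputable def affAct [P.IsCrystallographic] (b : P.Base) (θ : ι) (i : Option b.support)
    (l : ι × ℤ) : ι × ℤ :=
  (weylGroup.ofIdx P (simpleLabel b θ i).1 • l.1,
    l.2 - (simpleLabel b θ i).2 * P.pairingIn ℤ l.1 (simpleLabel b θ i).1)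

theorem affRoot_injective : Function.Injective (affRoot P) := by
  rintro ⟨j, k⟩ ⟨j', k'⟩ h
  simp only [affRoot, Prod.mk.injEq] at h
  exact Prod.ext (P.root.injective h.1) (Int.cast_injective h.2.2)

theorem affSimpleRoot_eq (b : P.Base) (θ : ι) (i : Option b.support) :
    affSimpleRoot b θ i = affRoot P (simpleLabel b θ i) := by
  cases i <;> simp [affSimpleRoot, affRoot, simpleLabel, root_negIdx, emb, delta]

theorem affSimpleCoroot_apply (b : P.Base) (θ : ι) (i : Option b.support) {μ : AffSpace V}
    (hμ : μ.2.1 = 0) :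
    affSimpleCoroot b θ i μ = P.toLinearMap μ.1 (P.coroot (simpleLabel b θ i).1) := by
  cases i <;> simp [affSimpleCoroot, simpleLabel, coroot_negIdx, hμ]

theorem affSimpleReflection_apply (b : P.Base) (θ : ι) (i : Option b.support) {μ : AffSpace V}
    (hμ : μ.2.1 = 0) :
    affSimpleReflection b θ i μ =
      μ - P.toLinearMap μ.1 (P.coroot (simpleLabel b θ i).1) • affRoot P (simpleLabel b θ i) := by
  rw [affSimpleReflection, Module.reflection_apply, affSimpleCoroot_apply b θ i hμ,
    affSimpleRoot_eq]

theorem affSimpleReflection_level (b : P.Base) (θ : ι) (i : Option b.support) (μ : AffSpace V) :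
    (affSimpleReflection b θ i μ).2.1 = μ.2.1 := by
  rw [affSimpleReflection, Module.reflection_apply, affSimpleRoot_eq]
  simp [affRoot]

theorem affSimpleReflection_fst (b : P.Base) (θ : ι) (i : Option b.support) {μ : AffSpace V}
    (hμ : μ.2.1 = 0) :
    (affSimpleReflection b θ i μ).1 = weylGroup.ofIdx P (simpleLabel b θ i).1 • μ.1 := by
  rw [affSimpleReflection_apply b θ i hμ, ofIdx_smul_eq]
  simp [affRoot]

theorem affSimpleReflection_affRoot [P.IsCrystallographic] (b : P.Base) (θ : ι)
    (i : Option b.support) (l : ι × ℤ) :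
    affSimpleReflection b θ i (affRoot P l) = affRoot P (affAct b θ i l) := by
  have h : P.toLinearMap (P.root l.1) (P.coroot (simpleLabel b θ i).1) =
      (P.pairingIn ℤ l.1 (simpleLabel b θ i).1 : ℚ) := by
    rw [root_coroot_eq_pairing, ← P.algebraMap_pairingIn ℤ]; simp
  rw [affSimpleReflection_apply b θ i rfl]
  refine Prod.ext ?_ (Prod.ext ?_ ?_)
  · simp only [affRoot, affAct, ← smul_root, ofIdx_smul_eq]
    simp
  · simp [affRoot]
  · simp only [affRoot, affAct] at h ⊢
    rw [h]
    simp [mul_comm]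

theorem affSimpleReflection_mem (b : P.Base) (θ : ι) (i : Option b.support) :
    affSimpleReflection b θ i ∈ affWeyl b θ :=
  Subgroup.subset_closure ⟨i, rfl⟩

theorem affSimpleReflection_inv (b : P.Base) (θ : ι) (i : Option b.support) :
    (affSimpleReflection b θ i)⁻¹ = affSimpleReflection b θ i := by
  refine inv_eq_of_mul_eq_one_left (LinearEquiv.ext fun x => ?_)
  exact Module.involutive_reflection (affSimpleCoroot_affSimpleRoot b θ i) x

/-- An element of the affine Weyl group acts on level-zero weights modulo `δ`, and on real roots
modulo `δ`, by one and the same element of the finite Weyl group. -/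
theorem exists_weylGroup_of_mem_affWeyl [P.IsCrystallographic] {b : P.Base} {θ : ι}
    {y : AffSpace V ≃ₗ[ℚ] AffSpace V} (hy : y ∈ affWeyl b θ) :
    ∃ w : P.weylGroup, (∀ μ, (y μ).2.1 = μ.2.1) ∧ (∀ μ, μ.2.1 = 0 → (y μ).1 = w • μ.1) ∧
      ∀ l, ∃ k, y (affRoot P l) = affRoot P (w • l.1, k) := by
  have hrefl (i : Option b.support) : ∃ w : P.weylGroup,
      (∀ μ, (affSimpleReflection b θ i μ).2.1 = μ.2.1) ∧
      (∀ μ, μ.2.1 = 0 → (affSimpleReflection b θ i μ).1 = w • μ.1) ∧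
      ∀ l, ∃ k, affSimpleReflection b θ i (affRoot P l) = affRoot P (w • l.1, k) :=
    ⟨_, affSimpleReflection_level b θ i, fun μ => affSimpleReflection_fst b θ i,
      fun l => ⟨_, affSimpleReflection_affRoot b θ i l⟩⟩
  induction hy using Subgroup.closure_induction'' with
  | one => exact ⟨1, fun _ => rfl, fun _ _ => (one_smul _ _).symm, fun l => ⟨l.2, by
      rw [one_smul]; rfl⟩⟩
  | mem _ h => obtain ⟨i, rfl⟩ := h; exact hrefl i
  | inv_mem _ h => obtain ⟨i, rfl⟩ := h; rw [affSimpleReflection_inv]; exact hrefl i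
  | mul y z _ _ hy hz =>
    obtain ⟨u, hu₁, hu₂, hu₃⟩ := hy
    obtain ⟨w, hw₁, hw₂, hw₃⟩ := hz
    refine ⟨u * w, fun μ => ?_, fun μ hμ => ?_, fun l => ?_⟩
    · rw [LinearEquiv.mul_apply, hu₁, hw₁]
    · rw [LinearEquiv.mul_apply, hu₂ _ (by rw [hw₁, hμ]), hw₂ _ hμ, mul_smul]
    · obtain ⟨k, hk⟩ := hw₃ l
      obtain ⟨k', hk'⟩ := hu₃ (w • l.1, k)
      exact ⟨k', by rw [LinearEquiv.mul_apply, hk, hk', mul_smul]⟩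

/-- The reflection and the coroot of an affine real root at level zero. -/
theorem HasReflectionCoroot.apply [P.IsCrystallographic] {b : P.Base} {θ : ι} {l : ι × ℤ}
    {r : AffSpace V ≃ₗ[ℚ] AffSpace V} {f : Dual ℚ (AffSpace V)}
    (h : HasReflectionCoroot b θ (affRoot P l) r f) {μ : AffSpace V} (hμ : μ.2.1 = 0) :
    f μ = P.toLinearMap μ.1 (P.coroot l.1) ∧ r μ = μ - f μ • affRoot P l := by
  obtain ⟨y, hy, i, hl, rfl, rfl⟩ := h
  obtain ⟨w, hw₁, hw₂, hw₃⟩ := exists_weylGroup_of_mem_affWeyl hy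
  obtain ⟨k, hk⟩ := hw₃ (simpleLabel b θ i)
  have hyy : y (y⁻¹ μ) = μ := y.apply_symm_apply μ
  have hμ' : (y⁻¹ μ).2.1 = 0 := by rw [← hw₁, hyy, hμ]
  have hl' : l = (w • (simpleLabel b θ i).1, k) :=
    affRoot_injective (by rw [hl, affSimpleRoot_eq, hk])
  constructor
  · change affSimpleCoroot b θ i (y⁻¹ μ) = _
    rw [affSimpleCoroot_apply b θ i hμ', hl', ← toLinearMap_smul_coroot_smul w, ← hw₂ _ hμ', hyy]
  · change y (affSimpleReflection b θ i (y⁻¹ μ)) = μ - affSimpleCoroot b θ i (y⁻¹ μ) • affRoot P l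
    rw [affSimpleReflection, Module.reflection_apply, map_sub, map_smul, hyy, hl]

section Positive

variable [P.IsRootSystem] {b : P.Base} {θ : ι}

theorem AffPos.mem_closure (hθ : IsHighestRoot b θ) {l : ι × ℤ} (hl : AffPos b l) :
    affRoot P l ∈ AddSubmonoid.closure (Set.range (affSimpleRoot b θ)) := by
  have hemb {v : V} (hv : v ∈ AddSubmonoid.closure (P.root '' b.support)) :
      (v, 0, 0) ∈ AddSubmonoid.closure (Set.range (affSimpleRoot b θ)) := by
    induction hv using AddSubmonoid.closure_induction with
    | mem x hx =>
      obtain ⟨i, hi, rfl⟩ := hx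
      exact AddSubmonoid.subset_closure ⟨some ⟨i, hi⟩, rfl⟩
    | zero => exact zero_mem _
    | add x y _ _ hx hy => simpa using add_mem hx hy
  obtain ⟨j, k⟩ := l
  rcases hl with hk | ⟨hk, hj⟩
  · obtain ⟨n, rfl⟩ : ∃ n : ℕ, k = n + 1 := ⟨(k - 1).toNat, by simp at hk; omega⟩
    have h₁ := hemb (hθ (negIdx P j))
    have h₂ := hemb (isPos_iff_mem_closure.1 hθ.isPos)
    have h₃ : affSimpleRoot b θ none ∈ AddSubmonoid.closure (Set.range (affSimpleRoot b θ)) :=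
      AddSubmonoid.subset_closure ⟨none, rfl⟩
    convert! add_mem h₁ (add_mem (nsmul_mem h₂ n) (nsmul_mem h₃ (n + 1))) using 1
    refine Prod.ext ?_ (Prod.ext ?_ ?_)
    · simp [affRoot, affSimpleRoot, delta, emb, root_negIdx]
      module
    · simp [affRoot, affSimpleRoot, delta, emb]
    · simp [affRoot, affSimpleRoot, delta, emb]
  · simp only at hk
    subst hk
    simpa [affRoot] using hemb (isPos_iff_mem_closure.1 hj)

theorem affPos_of_mem_closure {l : ι × ℤ}
    (h : affRoot P l ∈ AddSubmonoid.closure (Set.range (affSimpleRoot b θ))) : AffPos b l := by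
  have key {v : AffSpace V} (hv : v ∈ AddSubmonoid.closure (Set.range (affSimpleRoot b θ))) :
      ∃ n : ℕ, v.2.2 = n ∧ (n = 0 → v.1 ∈ AddSubmonoid.closure (P.root '' b.support)) := by
    induction hv using AddSubmonoid.closure_induction with
    | mem x hx =>
      obtain ⟨i, rfl⟩ := hx
      cases i with
      | none => exact ⟨1, by simp [affSimpleRoot, delta, emb], by simp⟩
      | some i =>
        exact ⟨0, by simp [affSimpleRoot, emb], fun _ => AddSubmonoid.subset_closure ⟨i, i.2, rfl⟩⟩
    | zero => exact ⟨0, by simp, fun _ => zero_mem _⟩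
    | add x y _ _ hx hy =>
      obtain ⟨n, hn, hn'⟩ := hx
      obtain ⟨m, hm, hm'⟩ := hy
      refine ⟨n + m, by simp [hn, hm], fun h => ?_⟩
      exact add_mem (hn' (by omega)) (hm' (by omega))
  obtain ⟨n, hn, hn'⟩ := key h
  have hn : (l.2 : ℚ) = n := hn
  have hn : l.2 = n := by exact_mod_cast hn
  rcases Nat.eq_zero_or_pos n with h₀ | h₀
  · exact .inr ⟨by omega, isPos_iff_mem_closure.2 (hn' h₀)⟩
  · exact .inl (by omega)

/-- The height of the affine real root `α_j + k δ` with respect to the simple affine roots. The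
height of `δ = α_0 + θ` is one more than that of `θ`. -/
noncomputable def affHeight (b : P.Base) (θ : ι) (l : ι × ℤ) : ℤ :=
  b.height l.1 + l.2 * (1 + b.height θ)

theorem IsHighestRoot.height_le (hθ : IsHighestRoot b θ) (j : ι) : b.height j ≤ b.height θ := by
  have := hθ.htFun_le j
  rw [htFun_root, htFun_root] at this
  exact_mod_cast this

theorem AffPos.affHeight_pos (hθ : IsHighestRoot b θ) {l : ι × ℤ} (hl : AffPos b l) :
    0 < affHeight b θ l := by
  have h₁ := hθ.height_le (negIdx P l.1)
  have h₂ : b.height (negIdx P l.1) = -b.height l.1 := b.height_reflectionPerm_self l.1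
  have h₃ := b.isPos_iff.1 hθ.isPos
  unfold affHeight
  rcases hl with hk | ⟨hk, hj⟩
  · nlinarith
  · rw [hk, zero_mul, add_zero]
    exact hj

omit [P.IsRootSystem] in
theorem affPos_simpleLabel (b : P.Base) (θ : ι) (i : Option b.support) :
    AffPos b (simpleLabel b θ i) := by
  cases i with
  | none => exact .inl le_rfl
  | some i => exact .inr ⟨rfl, Base.isPos_of_mem_support i.2⟩

omit [P.IsRootSystem] in
theorem affHeight_simpleLabel (b : P.Base) (θ : ι) (i : Option b.support) :
    affHeight b θ (simpleLabel b θ i) = 1 := by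
  cases i with
  | none =>
    have h₂ : b.height (negIdx P θ) = -b.height θ := b.height_reflectionPerm_self θ
    simp only [affHeight, simpleLabel, h₂]
    ring
  | some i => simp [affHeight, simpleLabel, Base.height_one_of_mem_support i.2]

variable [P.IsCrystallographic]

omit [P.IsRootSystem] in
theorem affHeight_affAct (b : P.Base) (θ : ι) (i : Option b.support) (l : ι × ℤ) :
    affHeight b θ (affAct b θ i l) =
      affHeight b θ l - P.pairingIn ℤ l.1 (simpleLabel b θ i).1 := by
  have h := affHeight_simpleLabel b θ i
  unfold affHeight at h ⊢
  rw [affAct, height_ofIdx_smul]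
  linear_combination -(P.pairingIn ℤ l.1 (simpleLabel b θ i).1) * h

omit [P.IsRootSystem] in
theorem pairingIn_negIdx_left (j i : ι) :
    P.pairingIn ℤ (negIdx P j) i = -P.pairingIn ℤ j i := by
  apply (algebraMap ℤ ℚ).injective_int
  rw [map_neg, P.algebraMap_pairingIn, P.algebraMap_pairingIn, ← root_coroot_eq_pairing,
    root_negIdx, map_neg, LinearMap.neg_apply, root_coroot_eq_pairing]

omit [P.IsRootSystem] in
theorem pairingIn_negIdx_right (j i : ι) :
    P.pairingIn ℤ j (negIdx P i) = -P.pairingIn ℤ j i := by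
  apply (algebraMap ℤ ℚ).injective_int
  rw [map_neg, P.algebraMap_pairingIn, P.algebraMap_pairingIn, ← root_coroot_eq_pairing,
    coroot_negIdx, map_neg, root_coroot_eq_pairing]

variable [Finite ι]

omit [P.IsRootSystem] in
/-- Some simple affine coroot is positive on any given affine real root. -/
theorem IsHighestRoot.exists_desc (hθ : IsHighestRoot b θ) (l : ι × ℤ) :
    ∃ i, 0 < P.pairingIn ℤ l.1 (simpleLabel b θ i).1 := by
  by_cases hj : b.IsPos l.1
  · obtain ⟨i, hi, h⟩ := hj.exists_mem_support_pos_pairingIn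
    exact ⟨some ⟨i, hi⟩, (P.zero_lt_pairingIn_iff' ℤ).1 h⟩
  · by_contra! hc
    -- with `α` the root of `l`, the coroot of `α` is nonpositive on `θ + α`, hence negative on `θ`
    have h₁ (v : V) (hv : v ∈ AddSubmonoid.closure (P.root '' b.support)) :
        P.toLinearMap v (P.coroot l.1) ≤ 0 := by
      induction hv using AddSubmonoid.closure_induction with
      | mem x hx =>
        obtain ⟨i, hi, rfl⟩ := hx
        have h := hc (some ⟨i, hi⟩)
        rw [← not_lt, simpleLabel, P.zero_lt_pairingIn_iff' ℤ, not_lt] at h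
        rw [root_coroot_eq_pairing, ← P.algebraMap_pairingIn ℤ]
        simpa using h
      | zero => simp
      | add x y _ _ hx hy => rw [map_add, LinearMap.add_apply]; exact add_nonpos hx hy
    have h₂ := h₁ _ (hθ (negIdx P l.1))
    rw [root_negIdx, sub_neg_eq_add, map_add, LinearMap.add_apply, root_coroot_two,
      root_coroot_eq_pairing, ← P.algebraMap_pairingIn ℤ, algebraMap_int_eq, eq_intCast] at h₂
    have h₃ : P.pairingIn ℤ θ l.1 < 0 := by
      have : (P.pairingIn ℤ θ l.1 : ℚ) < 0 := by linarith
      exact_mod_cast this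
    have h₄ := hc none
    rw [simpleLabel, pairingIn_negIdx_right] at h₄
    have := (P.pairingIn_lt_zero_iff ℤ).1 h₃
    omega

/-- A simple affine reflection permutes the positive affine real roots other than its own root. -/
theorem AffPos.affAct [P.IsReduced] (hθ : IsHighestRoot b θ) {l : ι × ℤ} (hl : AffPos b l)
    {i : Option b.support} (hne : l ≠ simpleLabel b θ i) : AffPos b (affAct b θ i l) := by
  obtain ⟨j, k⟩ := l
  cases i with
  | some i =>
    rcases hl with hk | ⟨hk, hj⟩
    · left
      simpa [LevelZero.affAct, simpleLabel] using hk
    · simp only at hk hj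
      subst hk
      refine .inr ⟨by simp [LevelZero.affAct, simpleLabel], isPos_ofIdx_smul i.2 hj ?_⟩
      rintro rfl
      exact hne rfl
  | none =>
    have h₁ : LevelZero.affAct b θ none (j, k) =
        (weylGroup.ofIdx P θ • j, k + P.pairingIn ℤ j θ) := by
      simp only [LevelZero.affAct, simpleLabel, ofIdx_negIdx, pairingIn_negIdx_right]
      rw [one_mul, sub_neg_eq_add]
    rw [h₁]
    rcases hl with hk | ⟨hk, hj⟩
    · simp only at hk
      by_cases hjθ : j = negIdx P θ
      · subst hjθ
        rw [smul_negIdx, ofIdx_smul_self, negIdx_negIdx, pairingIn_negIdx_left, pairingIn_same]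
        have : k ≠ 1 := fun h => hne (by rw [h]; rfl)
        by_cases h2 : k = 2
        · exact .inr ⟨by simp [h2], hθ.isPos⟩
        · left
          simp only
          omega
      · have h₂ := hθ.pairingIn_le_one (i := negIdx P j)
          (fun h => hjθ (by rw [← h, negIdx_negIdx]))
        rw [pairingIn_negIdx_left] at h₂
        by_cases h₃ : k + P.pairingIn ℤ j θ = 0
        · refine .inr ⟨h₃, ?_⟩
          have := hθ.not_isPos_of_pairingIn (i := negIdx P j)
            (by rw [pairingIn_negIdx_left]; omega)
          rwa [smul_negIdx, isPos_negIdx, not_not] at this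
        · left
          simp only
          omega
    · simp only at hk hj
      subst hk
      rcases (hθ.pairingIn_nonneg hj).lt_or_eq with h | h
      · left
        simp only
        omega
      · refine .inr ⟨by simp [← h], ?_⟩
        rw [ofIdx_smul_of_pairingIn_eq_zero h.symm]
        exact hj

omit [P.IsRootSystem] [Finite ι] in
theorem affAct_affAct (b : P.Base) (θ : ι) (i : Option b.support) (l : ι × ℤ) :
    LevelZero.affAct b θ i (LevelZero.affAct b θ i l) = l := by
  apply affRoot_injective (P := P)
  rw [← affSimpleReflection_affRoot, ← affSimpleReflection_affRoot]
  exact Module.involutive_reflection (affSimpleCoroot_affSimpleRoot b θ i) _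

/-- Every positive affine real root is conjugate to a simple affine root. -/
theorem AffPos.exists_conj [P.IsReduced] (hθ : IsHighestRoot b θ) {l : ι × ℤ} (hl : AffPos b l) :
    ∃ x ∈ affWeyl b θ, ∃ i, affRoot P l = x (affSimpleRoot b θ i) := by
  induction hn : (affHeight b θ l).toNat using Nat.strong_induction_on generalizing l with
  | _ n ih =>
    obtain ⟨i, hi⟩ := hθ.exists_desc l
    by_cases hs : l = simpleLabel b θ i
    · exact ⟨1, one_mem _, i, by rw [hs, affSimpleRoot_eq]; rfl⟩
    · have h₁ := hl.affAct hθ hs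
      have h₂ := h₁.affHeight_pos hθ
      have h₃ := affHeight_affAct b θ i l
      obtain ⟨x, hx, j, hj⟩ := ih _ (by omega) h₁ rfl
      refine ⟨affSimpleReflection b θ i * x, mul_mem (affSimpleReflection_mem b θ i) hx, j, ?_⟩
      rw [LinearEquiv.mul_apply, ← hj, affSimpleReflection_affRoot, affAct_affAct]

theorem mem_affPosRoots_iff [P.IsReduced] (hθ : IsHighestRoot b θ) {β : AffSpace V} :
    β ∈ affPosRoots b θ ↔ ∃ l, AffPos b l ∧ β = affRoot P l := by
  constructor
  · rintro ⟨⟨x, hx, i, rfl⟩, h⟩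
    obtain ⟨w, -, -, hw⟩ := exists_weylGroup_of_mem_affWeyl hx
    obtain ⟨k, hk⟩ := hw (simpleLabel b θ i)
    rw [affSimpleRoot_eq, hk] at h ⊢
    exact ⟨_, affPos_of_mem_closure h, rfl⟩
  · rintro ⟨l, hl, rfl⟩
    exact ⟨hl.exists_conj hθ, hl.mem_closure hθ⟩

/-- The labels between level-zero weights, in coordinates. -/
theorem isLabel_iff [P.IsReduced] (hθ : IsHighestRoot b θ) {β μ ν : AffSpace V}
    (hμ : μ.2.1 = 0) :
    IsLabel b θ β μ ν ↔ ∃ l, β = affRoot P l ∧ AffPos b l ∧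
      0 < P.toLinearMap μ.1 (P.coroot l.1) ∧
      ν = μ - P.toLinearMap μ.1 (P.coroot l.1) • affRoot P l := by
  constructor
  · rintro ⟨hβ, r, f, h, hpos, rfl⟩
    obtain ⟨l, hl, rfl⟩ := (mem_affPosRoots_iff hθ).1 hβ
    obtain ⟨h₁, h₂⟩ := h.apply hμ
    exact ⟨l, rfl, hl, h₁ ▸ hpos, h₁ ▸ h₂⟩
  · rintro ⟨l, rfl, hl, hpos, rfl⟩
    obtain ⟨x, hx, i, hi⟩ := hl.exists_conj hθ
    have h : HasReflectionCoroot b θ (affRoot P l) _ _ := ⟨x, hx, i, hi, rfl, rfl⟩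
    obtain ⟨h₁, h₂⟩ := h.apply hμ
    exact ⟨(mem_affPosRoots_iff hθ).2 ⟨l, hl, rfl⟩, _, _, h, h₁ ▸ hpos, by rw [h₂, h₁]⟩

end Positive

end AffineRoots

section WeightPoset

/-! ### Covers of the level-zero weight poset -/

section Orbit

variable {b : P.Base} {θ : ι} {lam : V}

theorem orbit_level [P.IsCrystallographic] {μ : AffSpace V} (hμ : μ ∈ orbit b θ lam) :
    μ.2.1 = 0 := by
  obtain ⟨y, hy, rfl⟩ := hμ
  obtain ⟨w, hw, -⟩ := exists_weylGroup_of_mem_affWeyl hy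
  exact hw _

theorem orbit_cl [P.IsCrystallographic] {μ : AffSpace V} (hμ : μ ∈ orbit b θ lam) :
    ∃ w : P.weylGroup, w • lam = cl μ := by
  obtain ⟨y, hy, rfl⟩ := hμ
  obtain ⟨w, -, hw, -⟩ := exists_weylGroup_of_mem_affWeyl hy
  exact ⟨w, (hw (emb lam) rfl).symm⟩

theorem smul_mem_orbit {y : AffSpace V ≃ₗ[ℚ] AffSpace V} (hy : y ∈ affWeyl b θ) {μ : AffSpace V}
    (hμ : μ ∈ orbit b θ lam) : y μ ∈ orbit b θ lam := by
  obtain ⟨z, hz, rfl⟩ := hμ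
  exact ⟨y * z, mul_mem hy hz, rfl⟩

/-- The reflection of an element of the orbit in an affine real root stays in the orbit. -/
theorem sub_smul_affRoot_mem_orbit [P.IsRootSystem] [P.IsCrystallographic] [P.IsReduced]
    [Finite ι] (hθ : IsHighestRoot b θ) {l : ι × ℤ} (hl : AffPos b l) {μ : AffSpace V}
    (hμ : μ ∈ orbit b θ lam) :
    μ - P.toLinearMap μ.1 (P.coroot l.1) • affRoot P l ∈ orbit b θ lam := by
  obtain ⟨x, hx, i, hi⟩ := hl.exists_conj hθ
  have h : HasReflectionCoroot b θ (affRoot P l) _ _ := ⟨x, hx, i, hi, rfl, rfl⟩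
  obtain ⟨h₁, h₂⟩ := h.apply (orbit_level hμ)
  rw [← h₁, ← h₂]
  exact smul_mem_orbit (mul_mem (mul_mem hx (affSimpleReflection_mem b θ i)) (inv_mem hx)) hμ

end Orbit

variable [P.IsRootSystem] [P.IsCrystallographic] [P.IsReduced] [Fintype ι]

/-- The change of the signed count under a simple affine reflection. -/
theorem signSum_simpleLabel {b : P.Base} {θ : ι} (hθ : IsHighestRoot b θ) (i : Option b.support)
    (x : V) :
    signSum b (weylGroup.ofIdx P (simpleLabel b θ i).1 • x) =
      signSum b x - 4 * corootSgn P x (simpleLabel b θ i).1 +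
        2 * (simpleLabel b θ i).2 *
          P.toLinearMap (signRoot P x) (P.coroot (simpleLabel b θ i).1) := by
  cases i with
  | none =>
    simp only [simpleLabel, ofIdx_negIdx, corootSgn_negIdx, coroot_negIdx, map_neg,
      hθ.signSum_smul]
    push_cast
    ring
  | some i =>
    simp only [simpleLabel, signSum_simple b i.2]
    push_cast
    ring

/-- The degree of the edge labeled `α_j + k δ` from a level-zero weight over `x`: in terms of
minimal representatives, `ℓ(⌊r_j w⌋) - ℓ(w) + k ⟨(w⁻¹ j)^∨, 2ρ - 2ρ_J⟩`, where `x = w λ`. -/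
noncomputable def affDeg (b : P.Base) (l : ι × ℤ) (x : V) : ℚ :=
  (signSum b x - signSum b (weylGroup.ofIdx P l.1 • x)) / 4 +
    l.2 * P.toLinearMap (signRoot P x) (P.coroot l.1) / 2

theorem affDeg_simpleLabel {b : P.Base} {θ : ι} (hθ : IsHighestRoot b θ) (i : Option b.support)
    (x : V) : affDeg b (simpleLabel b θ i) x = corootSgn P x (simpleLabel b θ i).1 := by
  rw [affDeg, signSum_simpleLabel hθ]
  ring

/-- The contributions of `r_0` to the two terms of the degree cancel except for the signs. -/
theorem affDeg_affAct {b : P.Base} {θ : ι} (hθ : IsHighestRoot b θ) (i : Option b.support)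
    (l : ι × ℤ) (x : V) :
    affDeg b (affAct b θ i l) (weylGroup.ofIdx P (simpleLabel b θ i).1 • x) =
      affDeg b l x + corootSgn P (weylGroup.ofIdx P l.1 • x) (simpleLabel b θ i).1 -
        corootSgn P x (simpleLabel b θ i).1 := by
  have h₁ : weylGroup.ofIdx P (weylGroup.ofIdx P (simpleLabel b θ i).1 • l.1) •
      weylGroup.ofIdx P (simpleLabel b θ i).1 • x =
      weylGroup.ofIdx P (simpleLabel b θ i).1 • weylGroup.ofIdx P l.1 • x := by
    rw [ofIdx_smul_idx_eq_conj, ofIdx_inv, mul_smul, mul_smul, ofIdx_smul_self_smul]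
  have h₂ : P.toLinearMap (P.root l.1) (P.coroot (simpleLabel b θ i).1) =
      (P.pairingIn ℤ l.1 (simpleLabel b θ i).1 : ℚ) := by
    rw [root_coroot_eq_pairing, ← P.algebraMap_pairingIn ℤ]; simp
  unfold affDeg
  rw [affAct]
  simp only
  rw [h₁, signSum_simpleLabel hθ, signSum_simpleLabel hθ, signRoot_smul, signRoot_smul,
    toLinearMap_smul_coroot_smul, ofIdx_smul_eq l.1 (signRoot P x), map_sub, map_smul,
    LinearMap.sub_apply, LinearMap.smul_apply, h₂, smul_eq_mul]
  push_cast
  ring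

/-- The level-zero weight poset as an order generated by reflections, with the simple affine
reflections acting. -/
noncomputable def weightOrder {b : P.Base} {θ : ι} (hθ : IsHighestRoot b θ) (lam : V) :
    ReflectionOrder (Option b.support) (orbit b θ lam) (ι × ℤ) where
  refl i μ := ⟨affSimpleReflection b θ i μ.1, smul_mem_orbit (affSimpleReflection_mem b θ i) μ.2⟩
  act := affAct b θ
  simple := simpleLabel b θ
  Edge l μ ν := AffPos b l ∧ 0 < P.toLinearMap μ.1.1 (P.coroot l.1) ∧
    ν.1 = μ.1 - P.toLinearMap μ.1.1 (P.coroot l.1) • affRoot P l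
  sgn i μ := SignType.sign (P.toLinearMap μ.1.1 (P.coroot (simpleLabel b θ i).1))
  rank μ := -(htFun b μ.1.1 + μ.1.2.2 * (1 + htFun b (P.root θ)))
  height l := (affHeight b θ l).toNat
  Desc i l := 0 < P.pairingIn ℤ l.1 (simpleLabel b θ i).1
  deg l μ := affDeg b l μ.1.1
  refl_refl i μ := Subtype.ext
    (Module.involutive_reflection (affSimpleCoroot_affSimpleRoot b θ i) μ.1)
  sgn_refl i μ := by
    rw [affSimpleReflection_fst b θ i (orbit_level μ.2), coroot_ofIdx_smul, Left.sign_neg]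
  refl_of_sgn_eq_zero i μ h := by
    rw [sign_eq_zero_iff] at h
    refine Subtype.ext ?_
    change affSimpleReflection b θ i μ.1 = μ.1
    rw [affSimpleReflection_apply b θ i (orbit_level μ.2), h, zero_smul, sub_zero]
  edge_simple i μ ν := by
    rw [sign_eq_one_iff, Subtype.ext_iff]
    change _ ↔ _ ∧ ν.1 = affSimpleReflection b θ i μ.1
    rw [affSimpleReflection_apply b θ i (orbit_level μ.2)]
    exact ⟨fun h => h.2, fun h => ⟨affPos_simpleLabel b θ i, h⟩⟩
  edge_act i l μ ν h hne := by
    obtain ⟨h₁, h₂, h₃⟩ := h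
    have h₄ : P.toLinearMap (affSimpleReflection b θ i μ.1).1 (P.coroot (affAct b θ i l).1) =
        P.toLinearMap μ.1.1 (P.coroot l.1) := by
      rw [affSimpleReflection_fst b θ i (orbit_level μ.2), affAct, toLinearMap_smul_coroot_smul]
    refine ⟨h₁.affAct hθ hne, by rwa [h₄], ?_⟩
    change affSimpleReflection b θ i ν.1 = affSimpleReflection b θ i μ.1 - _
    rw [h₄, h₃, map_sub, map_smul, affSimpleReflection_affRoot]
  edge_unique l l' μ ν h h' := by
    obtain ⟨-, h₁, h₂⟩ := h
    obtain ⟨-, h₃, h₄⟩ := h'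
    rw [h₂, sub_right_inj] at h₄
    obtain ⟨j, k⟩ := l
    obtain ⟨j', k'⟩ := l'
    have h₅ : j = j' := eq_of_smul_root_eq_smul_root h₁ h₃ (congrArg Prod.fst h₄)
    subst h₅
    exact affRoot_injective (smul_right_injective _ h₁.ne' h₄)
  rank_lt l μ ν h := by
    obtain ⟨h₁, h₂, h₃⟩ := h
    have h₄ : (0 : ℚ) < affHeight b θ l := by exact_mod_cast h₁.affHeight_pos hθ
    have h₅ : htFun b (P.root l.1) + l.2 * (1 + htFun b (P.root θ)) = affHeight b θ l := by
      rw [htFun_root, htFun_root, affHeight]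
      push_cast
      ring
    have h₆ := mul_pos h₂ h₄
    rw [h₃]
    simp only [affRoot, Prod.fst_sub, Prod.snd_sub, Prod.smul_fst, Prod.smul_snd, map_sub, map_smul,
      smul_eq_mul]
    rw [← h₅] at h₆
    linarith
  exists_desc l _ _ _ := hθ.exists_desc l
  height_lt i l μ ν h hne hd := by
    have h₁ := (h.1.affAct hθ hne).affHeight_pos hθ
    have h₂ := affHeight_affAct b θ i l
    omega
  sgn_le i l μ ν h hd := by
    obtain ⟨h₁, h₂, h₃⟩ := h
    have h₄ : P.toLinearMap ν.1.1 (P.coroot (simpleLabel b θ i).1) <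
        P.toLinearMap μ.1.1 (P.coroot (simpleLabel b θ i).1) := by
      have h₅ : (0 : ℚ) < P.toLinearMap (P.root l.1) (P.coroot (simpleLabel b θ i).1) := by
        rw [root_coroot_eq_pairing, ← P.algebraMap_pairingIn ℤ]
        simpa using hd
      have h₆ := mul_pos h₂ h₅
      rw [h₃]
      simp only [affRoot, Prod.fst_sub, Prod.smul_fst, map_sub, map_smul, LinearMap.sub_apply,
        LinearMap.smul_apply, smul_eq_mul]
      linarith
    refine ⟨SignType.sign.monotone h₄.le, fun h₅ h₆ => ?_⟩
    rw [sign_eq_zero_iff] at h₅ h₆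
    rw [h₅, h₆] at h₄
    exact lt_irrefl _ h₄
  deg_simple i μ ν h := by
    rw [affDeg_simpleLabel hθ, corootSgn, sign_pos h.2.1]
    simp
  deg_act i l μ ν h hne := by
    obtain ⟨h₁, h₂, h₃⟩ := h
    have h₄ : ν.1.1 = weylGroup.ofIdx P l.1 • μ.1.1 := by
      rw [h₃, ofIdx_smul_eq]
      rfl
    rw [affSimpleReflection_fst b θ i (orbit_level μ.2), affDeg_affAct hθ, h₄]
    rfl

end WeightPoset

section Edges

variable [P.IsCrystallographic] [P.IsReduced]

/-! ### Covers and edges of the parabolic quantum Bruhat graph -/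

theorem bruhatCover_iff_cover [Finite ι] {b : P.Base} {u v : P.weylGroup} :
    BruhatCover b u v ↔ (bruhatOrder b).Cover u v := by
  have h : (fun u v : P.weylGroup => ∃ i : ι, v = u * weylGroup.ofIdx P i ∧ len b u < len b v) =
      (bruhatOrder b).Step := by
    funext u v
    refine propext ⟨?_, ?_⟩
    · rintro ⟨i, rfl, hlt⟩
      have key (j : ι) (hj : b.IsPos j) (h : u * weylGroup.ofIdx P i = weylGroup.ofIdx P j * u) :
          (bruhatOrder b).Step u (u * weylGroup.ofIdx P i) := by
        refine ⟨j, hj, ?_, h⟩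
        by_contra hn
        have := len_ofIdx_mul_lt hj hn
        rw [h] at hlt
        omega
      by_cases hi : b.IsPos (u • i)
      · exact key _ hi (mul_ofIdx u i)
      · exact key _ (isPos_negIdx.2 hi) (by rw [ofIdx_negIdx, mul_ofIdx])
    · rintro ⟨j, hj, hj', rfl⟩
      exact ⟨u⁻¹ • j, ofIdx_mul u j, lt_len_ofIdx_mul hj hj'⟩
  unfold BruhatCover BruhatLT
  rw [h]
  rfl

/-- Covers of the Bruhat order raise the length by one. -/
theorem bruhatCover_iff_len [Finite ι] {b : P.Base} {u : P.weylGroup} {j : ι} (hj : b.IsPos j)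
    (hj' : b.IsPos (u⁻¹ • j)) :
    BruhatCover b u (weylGroup.ofIdx P j * u) ↔
      len b (weylGroup.ofIdx P j * u) = len b u + 1 := by
  have hE : (bruhatOrder b).Edge j u (weylGroup.ofIdx P j * u) := ⟨hj, hj', rfl⟩
  have hd : (bruhatOrder b).deg j u = 1 ↔ len b (weylGroup.ofIdx P j * u) = len b u + 1 := by
    change (len b (weylGroup.ofIdx P j * u) : ℚ) - len b u = 1 ↔ _
    rw [sub_eq_iff_eq_add, add_comm]
    exact_mod_cast Iff.rfl
  rw [bruhatCover_iff_cover, ← hd]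
  exact ⟨fun h => h.deg_eq_one hE, fun h => ReflectionOrder.cover_of_deg_eq_one hE h⟩

variable [P.IsRootSystem] [Fintype ι] {b : P.Base} {θ : ι} {lam : V}

omit [P.IsCrystallographic] [P.IsReduced] [P.IsRootSystem] in
theorem weylSgn_eq_sign (hlam : IsDominantWeight b lam) {w : P.weylGroup} {x : V}
    (hw : w • lam = x) {i : b.support}
    (h : SignType.sign (P.toLinearMap x (P.coroot i)) ≠ 0) :
    weylSgn b i w = SignType.sign (P.toLinearMap x (P.coroot i)) := by
  subst hw
  rw [sign_ne_zero] at h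
  rcases h.lt_or_gt with h | h
  · rw [weylSgn, if_neg (not_isPos_inv_smul_of_coroot_neg hlam h), sign_neg h]
  · rw [weylSgn, if_pos (isPos_inv_smul_of_coroot_pos hlam h), sign_pos h]

/-- For an edge of degree one with a finite label, the reflection raises the length by one even
before passing to cosets: along the descent to a simple label the signs that enter the degree are
never zero, so they are the signs that enter the length in `W`. -/
theorem len_of_deg_eq_one (hθ : IsHighestRoot b θ) (hlam : IsDominantWeight b lam)
    {l : ι × ℤ} {μ ν : orbit b θ lam} (hE : (weightOrder hθ lam).Edge l μ ν)
    (hd : (weightOrder hθ lam).deg l μ = 1) (hl : l.2 = 0) {w : P.weylGroup}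
    (hw : w • lam = cl μ.1) : len b (weylGroup.ofIdx P l.1 * w) = len b w + 1 := by
  refine ReflectionOrder.deg_one_induction (R := weightOrder hθ lam)
    (Q := fun l μ _ => l.2 = 0 → ∀ w : P.weylGroup, w • lam = cl μ.1 →
      len b (weylGroup.ofIdx P l.1 * w) = len b w + 1) ?_ ?_ hE hd hl w hw
  · intro i μ ν hE hl w hw
    cases i with
    | none => exact absurd hl one_ne_zero
    | some i =>
      refine len_ofIdx_mul_of_isPos i.2 (isPos_inv_smul_of_coroot_pos hlam ?_)
      rw [hw]
      exact hE.2.1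
  · intro i l μ ν hE _ _ hdesc heq hne ih hl w hw
    have hpos : b.IsPos l.1 := by
      rcases hE.1 with h | h
      · omega
      · exact h.2
    cases i with
    | none =>
      have h₁ : 0 < P.pairingIn ℤ l.1 (negIdx P θ) := hdesc
      have h₂ := hθ.pairingIn_nonneg hpos
      rw [pairingIn_negIdx_right] at h₁
      omega
    | some i =>
      have hw' : (weylGroup.ofIdx P l.1 * w) • lam = cl ν.1 := by
        rw [mul_smul, hw, ofIdx_smul_eq, cl, cl, hE.2.2]
        rfl
      have h₁ := weylSgn_eq_sign hlam hw hne
      have h₂ := weylSgn_eq_sign hlam hw' (by rw [heq] at hne; exact hne)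
      have h₃ := ih (by simpa [weightOrder, affAct, simpleLabel] using hl)
        (weylGroup.ofIdx P i * w) (by
          rw [mul_smul, hw]
          exact (affSimpleReflection_fst b θ (some i) (orbit_level μ.2)).symm)
      have h₄ : weylGroup.ofIdx P ((weightOrder hθ lam).act (some i) l).1 *
          (weylGroup.ofIdx P i * w) = weylGroup.ofIdx P i * (weylGroup.ofIdx P l.1 * w) := by
        change weylGroup.ofIdx P (weylGroup.ofIdx P (i : ι) • l.1) * (weylGroup.ofIdx P i * w) = _
        rw [ofIdx_smul_idx_eq_conj, ofIdx_inv, mul_assoc, ofIdx_mul_cancel, mul_assoc]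
      rw [h₄] at h₃
      have h₅ := len_ofIdx_mul_eq b i w
      have h₆ := len_ofIdx_mul_eq b i (weylGroup.ofIdx P l.1 * w)
      have h₇ : weylSgn b i w = weylSgn b i (weylGroup.ofIdx P l.1 * w) := by
        rw [h₁, h₂]; exact heq
      rw [h₃, ← h₇] at h₆
      push_cast at h₆
      have : (len b (weylGroup.ofIdx P l.1 * w) : ℚ) = len b w + 1 := by linarith
      exact_mod_cast this

/-- The label of an edge of degree one is `α` or `δ - α` with `α` a finite positive root. -/
theorem label_of_deg_eq_one (hθ : IsHighestRoot b θ) {l : ι × ℤ} {μ ν : orbit b θ lam}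
    (hE : (weightOrder hθ lam).Edge l μ ν) (hd : (weightOrder hθ lam).deg l μ = 1) :
    l.2 = 0 ∧ b.IsPos l.1 ∨ l.2 = 1 ∧ ¬ b.IsPos l.1 := by
  refine ReflectionOrder.deg_one_induction (R := weightOrder hθ lam)
    (Q := fun l _ _ => l.2 = 0 ∧ b.IsPos l.1 ∨ l.2 = 1 ∧ ¬ b.IsPos l.1) ?_ ?_ hE hd
  · intro i μ ν _
    cases i with
    | none =>
      refine .inr ⟨rfl, ?_⟩
      change ¬ b.IsPos (negIdx P θ)
      rw [isPos_negIdx, not_not]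
      exact hθ.isPos
    | some i => exact .inl ⟨rfl, Base.isPos_of_mem_support i.2⟩
  · intro i l μ ν hE _ _ hdesc heq _ ih
    -- a label over the finite part of a simple affine root joins weights of opposite signs
    have hfin : l.1 ≠ (simpleLabel b θ i).1 := fun h => by
      have h₁ : SignType.sign (P.toLinearMap μ.1.1 (P.coroot (simpleLabel b θ i).1)) =
        SignType.sign (P.toLinearMap ν.1.1 (P.coroot (simpleLabel b θ i).1)) := heq
      have h₂ : ν.1.1 = weylGroup.ofIdx P l.1 • μ.1.1 := by
        rw [ofIdx_smul_eq, hE.2.2]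
        rfl
      have h₃ := hE.2.1
      rw [h₂, ← h, coroot_ofIdx_smul, Left.sign_neg, sign_pos h₃] at h₁
      exact absurd h₁ (by decide)
    have hdesc' : 0 < P.pairingIn ℤ l.1 (simpleLabel b θ i).1 := hdesc
    rcases hE.1 with hk | hk
    · cases i with
      | some i =>
        have ih' : l.2 = 0 ∧ b.IsPos (weylGroup.ofIdx P (i : ι) • l.1) ∨
            l.2 = 1 ∧ ¬ b.IsPos (weylGroup.ofIdx P (i : ι) • l.1) := by
          simpa [weightOrder, affAct, simpleLabel] using ih
        rcases ih' with h | h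
        · omega
        · exact .inr ⟨h.1, fun h' => h.2 (isPos_ofIdx_smul i.2 h' hfin)⟩
      | none =>
        have ih' : l.2 + P.pairingIn ℤ l.1 θ = 0 ∧ b.IsPos (weylGroup.ofIdx P θ • l.1) ∨
            l.2 + P.pairingIn ℤ l.1 θ = 1 ∧ ¬ b.IsPos (weylGroup.ofIdx P θ • l.1) := by
          simpa [weightOrder, affAct, simpleLabel, ofIdx_negIdx, pairingIn_negIdx_right] using ih
        have hdesc'' : 0 < P.pairingIn ℤ l.1 (negIdx P θ) := hdesc'
        rw [pairingIn_negIdx_right] at hdesc''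
        have h₁ : ¬ b.IsPos l.1 := fun h => by
          have := hθ.pairingIn_nonneg h
          omega
        have h₂ := hθ.pairingIn_le_one (i := negIdx P l.1)
          (fun h => hfin (by rw [simpleLabel, ← h, negIdx_negIdx]))
        have h₃ := hθ.not_isPos_of_pairingIn (i := negIdx P l.1)
          (by rw [pairingIn_negIdx_left]; omega)
        rw [pairingIn_negIdx_left] at h₂
        rw [smul_negIdx, isPos_negIdx, not_not] at h₃
        rcases ih' with h | h
        · exact .inr ⟨by omega, h₁⟩
        · exact absurd h₃ h.2
    · exact .inl hk

omit [P.IsCrystallographic] [P.IsReduced] [Fintype ι] [P.IsRootSystem] in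
theorem isFloor_iff {w w' : P.weylGroup} {γ : ι} (hw' : w' ∈ minReps b lam) :
    IsFloor b lam (w * weylGroup.ofIdx P γ) w' ↔
      w' • lam = weylGroup.ofIdx P (w • γ) • w • lam := by
  rw [IsFloor, inv_mul_mem_stab, mul_ofIdx, mul_smul]
  exact ⟨fun h => h.2, fun h => ⟨hw', h⟩⟩

omit [P.IsRootSystem] in
/-- The degree of an edge in terms of the lengths of minimal representatives. -/
theorem affDeg_eq (hlam : IsDominantWeight b lam) {w w' : P.weylGroup} (hw : w ∈ minReps b lam)
    (hw' : w' ∈ minReps b lam) {γ : ι} {k : ℤ}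
    (h : w' • lam = weylGroup.ofIdx P (w • γ) • w • lam) :
    affDeg b (w • γ, k) (w • lam) = len b w' - len b w +
      k * P.toLinearMap ((2 : ℚ) • rho b - (2 : ℚ) • rhoJ b lam) (P.coroot γ) := by
  rw [affDeg, len_eq_of_mem_minReps hlam hw, len_eq_of_mem_minReps hlam hw']
  simp only
  rw [← h, signRoot_smul, toLinearMap_smul_coroot_smul, signRoot_eq hlam, map_smul,
    LinearMap.smul_apply, smul_eq_mul]
  ring

/-- Edges of degree one with finite label `w γ` are the Bruhat edges with label `γ`. -/
theorem bruhatEdge_iff (hθ : IsHighestRoot b θ) (hlam : IsDominantWeight b lam)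
    {w w' : P.weylGroup} (hw : w ∈ minReps b lam) (hw' : w' ∈ minReps b lam) {γ : ι}
    {μ ν : orbit b θ lam} (hμ : w • lam = cl μ.1) (hν : w' • lam = cl ν.1)
    (hE : (weightOrder hθ lam).Edge (w • γ, 0) μ ν) :
    BruhatEdge b lam w γ w' ↔ (weightOrder hθ lam).deg (w • γ, 0) μ = 1 := by
  have hE₂ : 0 < P.toLinearMap (w • lam) (P.coroot (w • γ)) := by rw [hμ]; exact hE.2.1
  rw [toLinearMap_smul_coroot_smul, ← mem_posIdx_diff_posIdxJ_iff hlam] at hE₂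
  have hpos : b.IsPos (w • γ) := by
    rcases hE.1 with h | h
    · exact absurd h (by simp)
    · exact h.2
  have hfl : w' • lam = weylGroup.ofIdx P (w • γ) • w • lam := by
    rw [hμ, hν, ofIdx_smul_eq, cl, hE.2.2]
    rfl
  have hcov := bruhatCover_iff_len (u := w) hpos (by rw [inv_smul_smul]; exact hE₂.1)
  rw [← mul_ofIdx] at hcov
  constructor
  · rintro ⟨-, -, -, hc⟩
    refine le_antisymm ?_ (ReflectionOrder.one_le_deg hE)
    have h₁ := le_len hlam (w * weylGroup.ofIdx P γ)
    rw [hcov.1 hc, mul_ofIdx, mul_smul, ← hfl, ← len_eq_of_mem_minReps hlam hw'] at h₁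
    have h₂ := affDeg_eq (k := 0) hlam hw hw' hfl
    rw [hμ] at h₂
    change affDeg b (w • γ, 0) (cl μ.1) ≤ 1
    rw [h₂]
    push_cast at h₁ ⊢
    linarith
  · intro hd
    refine ⟨hw, hE₂, (isFloor_iff hw').2 hfl, hcov.2 ?_⟩
    rw [mul_ofIdx]
    exact len_of_deg_eq_one hθ hlam hE hd rfl hμ

/-- Edges of degree one with label `δ + w γ` are the quantum edges with label `γ`. -/
theorem quantumEdge_iff (hθ : IsHighestRoot b θ) (hlam : IsDominantWeight b lam)
    {w w' : P.weylGroup} (hw : w ∈ minReps b lam) (hw' : w' ∈ minReps b lam) {γ : ι}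
    {μ ν : orbit b θ lam} (hμ : w • lam = cl μ.1) (hν : w' • lam = cl ν.1)
    (hE : (weightOrder hθ lam).Edge (w • γ, 1) μ ν) :
    QuantumEdge b lam w γ w' ↔ (weightOrder hθ lam).deg (w • γ, 1) μ = 1 := by
  have hE₂ : 0 < P.toLinearMap (w • lam) (P.coroot (w • γ)) := by rw [hμ]; exact hE.2.1
  rw [toLinearMap_smul_coroot_smul, ← mem_posIdx_diff_posIdxJ_iff hlam] at hE₂
  have hfl : w' • lam = weylGroup.ofIdx P (w • γ) • w • lam := by
    rw [hμ, hν, ofIdx_smul_eq, cl, hE.2.2]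
    rfl
  have h₂ := affDeg_eq (k := 1) hlam hw hw' hfl
  rw [hμ] at h₂
  change _ ↔ affDeg b (w • γ, 1) (cl μ.1) = 1
  rw [h₂]
  constructor
  · rintro ⟨-, -, -, h⟩
    rw [h]
    push_cast
    ring
  · intro h
    refine ⟨hw, hE₂, (isFloor_iff hw').2 hfl, ?_⟩
    push_cast at h
    linarith

theorem isLabel_iff_edge (hθ : IsHighestRoot b θ) {β : AffSpace V} {μ ν : orbit b θ lam} :
    IsLabel b θ β μ.1 ν.1 ↔ ∃ l, β = affRoot P l ∧ (weightOrder hθ lam).Edge l μ ν :=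
  isLabel_iff hθ (orbit_level μ.2)

theorem weightCover_iff_cover (hθ : IsHighestRoot b θ) {μ ν : orbit b θ lam} :
    WeightCover b θ lam μ ν ↔ (weightOrder hθ lam).Cover μ ν := by
  have h : (fun μ ν : orbit b θ lam => ∃ β, IsLabel b θ β μ.1 ν.1) =
      (weightOrder hθ lam).Step := by
    funext μ ν
    refine propext ⟨?_, ?_⟩
    · rintro ⟨β, hβ⟩
      obtain ⟨l, -, hl⟩ := (isLabel_iff_edge hθ).1 hβ
      exact ⟨l, hl⟩
    · rintro ⟨l, hl⟩
      exact ⟨_, (isLabel_iff_edge hθ).2 ⟨l, rfl, hl⟩⟩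
  unfold WeightCover WeightLT
  rw [h]
  rfl

/-- The edge with a given source and label. -/
theorem exists_edge (hθ : IsHighestRoot b θ) {l : ι × ℤ} (hl : AffPos b l) (μ : orbit b θ lam)
    (h : 0 < P.toLinearMap μ.1.1 (P.coroot l.1)) :
    ∃ ν : orbit b θ lam, (weightOrder hθ lam).Edge l μ ν ∧
      cl ν.1 = weylGroup.ofIdx P l.1 • cl μ.1 :=
  ⟨⟨_, sub_smul_affRoot_mem_orbit hθ hl μ.2⟩, ⟨hl, h, rfl⟩, by rw [ofIdx_smul_eq]; rfl⟩

omit [P.IsCrystallographic] [P.IsReduced] [P.IsRootSystem] [Fintype ι] in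
theorem eq_zero_and_isPos_of_mem_finPosRoots {l : ι × ℤ} (h : affRoot P l ∈ finPosRoots b) :
    l.2 = 0 ∧ b.IsPos l.1 := by
  obtain ⟨i, hi, h⟩ := h
  have h' : affRoot P l = affRoot P (i, 0) := by rw [h]; simp [affRoot, emb]
  rw [affRoot_injective h']
  exact ⟨rfl, hi⟩

omit [P.IsCrystallographic] [P.IsReduced] [P.IsRootSystem] [Fintype ι] in
theorem delta_sub_affRoot (l : ι × ℤ) :
    delta - affRoot P l = affRoot P (negIdx P l.1, 1 - l.2) := by
  simp [delta, affRoot, root_negIdx]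

omit [P.IsCrystallographic] [P.IsReduced] [P.IsRootSystem] [Fintype ι] in
theorem affRoot_zero (j : ι) : affRoot P (j, 0) = emb (P.root j) := by
  simp [affRoot, emb]

omit [P.IsCrystallographic] [P.IsReduced] [P.IsRootSystem] [Fintype ι] in
theorem affRoot_one (j : ι) : affRoot P (j, 1) = delta + emb (P.root j) := by
  simp [affRoot, emb, delta]

end Edges

end LevelZero

open LevelZero in
theorem mainTheorem3 {ι V V' : Type*} [Finite ι] [AddCommGroup V] [Module ℚ V]
    [AddCommGroup V'] [Module ℚ V'] (P : RootPairing ι ℚ V V') [P.IsRootSystem]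
    [P.IsCrystallographic] [P.IsReduced] [P.IsIrreducible] (b : P.Base)
    (θ : ι) (hθ : LevelZero.IsHighestRoot b θ)
    (lam : V) (hlam : LevelZero.IsDominantWeight b lam) :
    -- the identification of the classical weights `W λ` with `W^J`
    (∀ μ : LevelZero.orbit b θ lam,
      ∃! w : P.weylGroup, w ∈ LevelZero.minReps b lam ∧ w • lam = LevelZero.cl μ.1) ∧
    ∀ (μ : LevelZero.orbit b θ lam) (w : P.weylGroup), w ∈ LevelZero.minReps b lam →
      w • lam = LevelZero.cl μ.1 →
      -- covers project to edges
      (∀ ν : LevelZero.orbit b θ lam, LevelZero.WeightCover b θ lam μ ν →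
        (∃! β, LevelZero.IsLabel b θ β μ ν) ∧
        ∀ β, LevelZero.IsLabel b θ β μ ν →
          (β ∈ LevelZero.finPosRoots b ∨ LevelZero.delta - β ∈ LevelZero.finPosRoots b) ∧
          ∀ w' ∈ LevelZero.minReps b lam, w' • lam = LevelZero.cl ν.1 →
            (β ∈ LevelZero.finPosRoots b →
              ∃ γ, LevelZero.emb (w • P.root γ) = β ∧
                LevelZero.BruhatEdge b lam w γ w') ∧
            (LevelZero.delta - β ∈ LevelZero.finPosRoots b →
              ∃ γ, LevelZero.emb (w • P.root γ) = β - LevelZero.delta ∧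
                LevelZero.QuantumEdge b lam w γ w')) ∧
      -- edges lift to covers
      (∀ γ w', LevelZero.BruhatEdge b lam w γ w' →
        ∃ ν : LevelZero.orbit b θ lam, LevelZero.WeightCover b θ lam μ ν ∧
          LevelZero.IsLabel b θ (LevelZero.emb (w • P.root γ)) μ ν ∧
          w' • lam = LevelZero.cl ν.1) ∧
      (∀ γ w', LevelZero.QuantumEdge b lam w γ w' →
        ∃ ν : LevelZero.orbit b θ lam, LevelZero.WeightCover b θ lam μ ν ∧
          LevelZero.IsLabel b θ (LevelZero.delta + LevelZero.emb (w • P.root γ)) μ ν ∧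
          w' • lam = LevelZero.cl ν.1) := by
  classical
  have := Fintype.ofFinite ι

  refine ⟨fun μ => ?_, fun μ w hw hμ => ⟨fun ν hcov => ?_, fun γ w' hedge => ?_,
    fun γ w' hedge => ?_⟩⟩
  · obtain ⟨u, hu⟩ := orbit_cl μ.2
    obtain ⟨w, hw, hw'⟩ := exists_mem_minReps b lam u
    exact ⟨w, ⟨hw, hw'.trans hu⟩, fun v hv => minReps_unique hlam hv.1 hw (by rw [hv.2, hw', hu])⟩
  · rw [weightCover_iff_cover hθ] at hcov
    obtain ⟨l, hE⟩ := hcov.exists_edge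
    have hd := hcov.deg_eq_one hE
    have huniq : ∀ β, IsLabel b θ β μ.1 ν.1 → β = affRoot P l := fun β hβ => by
      obtain ⟨l', rfl, hl'⟩ := (isLabel_iff_edge hθ).1 hβ
      rw [(weightOrder hθ lam).edge_unique _ _ _ _ hl' hE]
    refine ⟨⟨_, (isLabel_iff_edge hθ).2 ⟨l, rfl, hE⟩, huniq⟩, fun β hβ => ?_⟩
    obtain rfl := huniq β hβ
    obtain ⟨γ, hγ⟩ : ∃ γ, w • γ = l.1 := ⟨_, smul_inv_smul w l.1⟩
    refine ⟨?_, fun w' hw' hν => ⟨fun hfin => ?_, fun hfin => ?_⟩⟩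
    · obtain ⟨j, k⟩ := l
      rcases label_of_deg_eq_one hθ hE hd with ⟨h₁, h₂⟩ | ⟨h₁, h₂⟩
      · simp only at h₁ h₂
        subst h₁
        exact .inl ⟨j, h₂, affRoot_zero j⟩
      · simp only at h₁ h₂
        subst h₁
        refine .inr ⟨negIdx P j, isPos_negIdx.2 h₂, ?_⟩
        rw [delta_sub_affRoot, ← affRoot_zero, sub_self]
    · have hl : l = (w • γ, 0) := Prod.ext hγ.symm (eq_zero_and_isPos_of_mem_finPosRoots hfin).1
      subst hl
      exact ⟨γ, by rw [smul_root, affRoot_zero],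
        (bruhatEdge_iff hθ hlam hw hw' hμ hν hE).2 hd⟩
    · rw [delta_sub_affRoot] at hfin
      have hk := (eq_zero_and_isPos_of_mem_finPosRoots hfin).1
      have hl : l = (w • γ, 1) := Prod.ext hγ.symm (by simp only at hk ⊢; omega)
      subst hl
      exact ⟨γ, by rw [smul_root, affRoot_one, add_sub_cancel_left],
        (quantumEdge_iff hθ hlam hw hw' hμ hν hE).2 hd⟩
  · have hw' : w' ∈ minReps b lam := hedge.2.2.1.1
    have hfl := (isFloor_iff hw').1 hedge.2.2.1
    have hpair := (mem_posIdx_diff_posIdxJ_iff hlam).1 hedge.2.1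
    rw [← toLinearMap_smul_coroot_smul w, hμ] at hpair
    have hpos : b.IsPos (w • γ) := by
      by_contra hn
      have h₁ := len_mul_ofIdx_lt hedge.2.1.1 hn
      have h₂ : len b w < len b (w * RootPairing.weylGroup.ofIdx P γ) := by
        have h₃ := (bruhatCover_iff_cover.1 hedge.2.2.2).1.rank_lt
        exact Nat.cast_lt.1 h₃
      omega
    obtain ⟨ν, hE, hν⟩ := exists_edge hθ (l := (w • γ, 0)) (.inr ⟨rfl, hpos⟩) μ hpair
    have hν' : w' • lam = cl ν.1 := by rw [hfl, hν, hμ]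
    refine ⟨ν, (weightCover_iff_cover hθ).2 (ReflectionOrder.cover_of_deg_eq_one hE
      ((bruhatEdge_iff hθ hlam hw hw' hμ hν' hE).1 hedge)), ?_, hν'⟩
    exact (isLabel_iff_edge hθ).2 ⟨_, by rw [smul_root, affRoot_zero], hE⟩
  · have hw' : w' ∈ minReps b lam := hedge.2.2.1.1
    have hfl := (isFloor_iff hw').1 hedge.2.2.1
    have hpair := (mem_posIdx_diff_posIdxJ_iff hlam).1 hedge.2.1
    rw [← toLinearMap_smul_coroot_smul w, hμ] at hpair
    obtain ⟨ν, hE, hν⟩ := exists_edge hθ (l := (w • γ, 1)) (.inl le_rfl) μ hpair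
    have hν' : w' • lam = cl ν.1 := by rw [hfl, hν, hμ]
    refine ⟨ν, (weightCover_iff_cover hθ).2 (ReflectionOrder.cover_of_deg_eq_one hE
      ((quantumEdge_iff hθ hlam hw hw' hμ hν' hE).1 hedge)), ?_, hν'⟩
    exact (isLabel_iff_edge hθ).2 ⟨_, by rw [smul_root, affRoot_one], hE⟩
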